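/- Work on $\mathbb R^4$ with $\eta=\mathrm{diag}(-1,1,1,1)$, $k\cdot x=\eta_{\mu\nu}k^\mu x^\nu$; a vector $k=(\omega,\vec k)$ is timelike, spacelike, or lightlike if $k\cdot k<0$, $k\cdot k>0$, or $k\cdot k=0$ and $k\neq0$. A defect line of unit energy density with unit direction $\hat d$, velocity $\vec v\perp\hat d$ and position $\vec X\perp\hat d$ at $t=0$ has the distributional energy–momentum tensor $\hat T_{\mu\nu}[\vec X,\hat d,\vec v]=(u_\mu u_\nu+u^2d_\mu d_\nu)\,\delta_{\Sigma}$, where $u=(1,\vec v)$, $d=(0,\hat d)$, and $\delta_\Sigma(f)=\int\!\!\int f(t,\vec X+t\vec v+s\hat d)\,dt\,ds$. It is non-spacelike if $|\vec v|\le1$. The laminar plane wave with parameters $(\vec k,\hat d,\vec v)$, $\vec k,\vec v\perp\hat d$, has energy–momentum tensor $\hat T^{\rm lp}_{\mu\nu}[\vec k,\hat d,\vec v]=\int_{\vec X\perp\hat d}e^{2\pi i\vec k\cdot\vec X}\,\hat T_{\mu\nu}[\vec X,\hat d,\vec v]\,d\vec X$. In the weak-field limit a distribution of non-spacelike defects is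 given by its amplitude $\bar\rho$, a complex measure of at most polynomial growth in $\vec k$ on the set of parameters $(\vec k,\hat d,\vec v)$ with $|\hat d|=1$, $\vec k,\vec v\perp\hat d$, $|\vec v|\le 1$ (its density in $\vec X$ is the superposition of the waves $e^{2\pi i\vec k\cdot\vec X}$; it is real if $\bar\rho(-\vec k,\hat d,\vec v)=\overline{\bar\rho(\vec k,\hat d,\vec v)}$). Its energy–momentum tensor is the tempered distribution $T_{\mu\nu}[\bar\rho]=\int \hat T^{\rm lp}_{\mu\nu}\,d\bar\rho$. A Fourier transform of it is a pair of a $\sigma$-finite measure $m$ on $\mathbb R^4$ and a polynomially bounded (i.e. integrable with respect to $m$ after division by a power of $1+|k|$) density $T_{\mu\nu}(k)$ with $T_{\mu\nu}[\bar\rho](x)=\int T_{\mu\nu}(k)\,e^{2\pi i k\cdot x}\,m(dk)$ in the sense of distributions. **Restrictions.** Every such $T_{\mu\nu}[\bar\rho]$ has a Fourier transform $(m,T_{\mu\nu}(k))$ with the following properties for every $k$, and every Fourier transform of it has them for $m$-almost every $k$: 1. $k^\mu T_{\mu\nu}(k)=0$; 2. $T_{\mu\nu}(k)=0$ if $k$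 is timelike; 3. if $k$ is lightlike, then for each lightlike $l$ the covector $w_\nu=l^\mu T_{\mu\nu}(k)$ is non-spacelike, that is, $\eta^{\mu\nu}\,\mathrm{Re}(cw_\mu)\,\mathrm{Re}(cw_\nu)\le0$ for all $c\in\mathbb C$. **Converse.** Let $k$ be spacelike or zero and let $T_{\mu\nu}$ be a complex symmetric tensor with $k^\mu T_{\mu\nu}=0$. Then some distribution of non-spacelike defects has the single-mode energy–momentum tensor $T_{\mu\nu}e^{2\pi ik\cdot x}$, and some real one has $\mathrm{Re}(T_{\mu\nu}e^{2\pi ik\cdot x})$. Both may be taken with a continuous density with respect to the natural measure $d\hat d\,dv$ on the laminar plane waves of non-spacelike defects with wave vector $k$ (respectively $\pm k$). For spacelike $k=(\omega,\vec k)$ these waves are parametrised by unit $\hat d\perp\vec k$ and $v$ with $v^2\le k\cdot k$, with velocity $\vec v=\omega\vec k/\vec k^2+v\,\vec k\times\hat d/\vec k^2$; for $k=0$ by all unit $\hat d$ and all $\vec v\perp\hat d$ with $|\vec v|\le1$, with measure $d\hat d\,d\vec v$. -/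

import Mathlib

open MeasureTheory
open scoped SchwartzMap

noncomputable section

namespace LineDefect

/-- Euclidean three-space; positions, directions, velocities and spatial wave vectors live here. -/
abbrev Space := EuclideanSpace ℝ (Fin 3)

/-- Coordinate four-space; contravariant components `(x⁰, x¹, x², x³)`, with `x⁰` the time. -/
abbrev FourVec := EuclideanSpace ℝ (Fin 4)

/-- The four-vector `(t, x)`. -/
def fourVec (t : ℝ) (x : Space) : FourVec := !₂[t, x 0, x 1, x 2]

/-- The spatial part of a four-vector. -/
def spatial (k : FourVec) : Space := !₂[k 1, k 2, k 3]

/-- The diagonal entries of the Minkowski metric, signature `(- + + +)`. -/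
def eta (μ : Fin 4) : ℝ := if μ = 0 then -1 else 1

/-- The Minkowski product `k_μ x^μ`. -/
def mink (k x : FourVec) : ℝ := ∑ μ, eta μ * k μ * x μ

/-- The covariant components `k_μ`. -/
def lower (k : FourVec) (μ : Fin 4) : ℝ := eta μ * k μ

def IsTimelike (k : FourVec) : Prop := mink k k < 0

def IsSpacelike (k : FourVec) : Prop := 0 < mink k k

def IsLightlike (k : FourVec) : Prop := k ≠ 0 ∧ mink k k = 0

/-- A complex covector `w_ν`, read as the amplitude of an oscillation, is non-spacelike if
the real covector `Re (c w_ν)` is timelike, lightlike or zero for each constant `c`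
(in particular the real and imaginary parts of `w` are non-spacelike). -/
def IsNonSpacelike (w : Fin 4 → ℂ) : Prop :=
  ∀ c : ℂ, ∑ ν, eta ν * (c * w ν).re ^ 2 ≤ 0

/-- Complex covariant 2-tensors `T_{μν}`. -/
abbrev Tensor := Matrix (Fin 4) (Fin 4) ℂ

/-- The contraction `l^μ T_{μν}`. -/
def contract (l : FourVec) (T : Tensor) (ν : Fin 4) : ℂ := ∑ μ, (l μ : ℂ) * T μ ν

/-- The plane wave `x ↦ exp (2πi k_μ x^μ)`. -/
def wave (k x : FourVec) : ℂ := Complex.exp (2 * Real.pi * Complex.I * (mink k x : ℂ))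

/-! ### Single defects and laminar plane waves -/

/-- The constant tensor `u_μ u_ν + u² d_μ d_ν`, where `u = (1, v)` and `d = (0, d)`. Its
`00`-component is `1`; for `v = 0` and `d = e_z` it is `diag (1, 0, 0, -1)`. -/
def sheetTensor (d v : Space) : Tensor := fun μ ν =>
  ((lower (fourVec 1 v) μ * lower (fourVec 1 v) ν +
    mink (fourVec 1 v) (fourVec 1 v) * (lower (fourVec 0 d) μ * lower (fourVec 0 d) ν) : ℝ) : ℂ)

/-- The energy--momentum tensor of a single defect line of unit energy density with position `X`
at time `0`, direction `d` and velocity `v`. It is the tensor-valued distribution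
`(u_μ u_ν + u² d_μ d_ν) δ²(x_⊥ - X - t v)` carried by the world sheet
`{(t, X + t v + s d)}` and is given here by its pairing with a test function `f`. -/
def defectT (X d v : Space) (f : 𝓢(FourVec, ℂ)) : Tensor :=
  (∫ t : ℝ, ∫ s : ℝ, f (fourVec t (X + t • v + s • d))) • sheetTensor d v

/-- Parameters `(k, d, v)` of a laminar plane wave: (spatial) wave vector, direction, velocity. -/
abbrev Laminar := Space × Space × Space

/-- The parameters of the laminar plane waves of non-spacelike defects: `d` is a unit vector, `k` and
`v` are orthogonal to `d`, and the speed is at most the speed of light. (`d` and `-d` describe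
the same defects.) -/
def IsPhysical (p : Laminar) : Prop :=
  ‖p.2.1‖ = 1 ∧ inner ℝ p.1 p.2.1 = 0 ∧ inner ℝ p.2.2 p.2.1 = 0 ∧ ‖p.2.2‖ ≤ 1

/-- The energy--momentum tensor of a laminar plane wave, i.e. of the configuration of parallel
defects with fixed `d` and `v` whose energy density at position `X ⊥ d` is `exp (2πi k·X)`. -/
def laminarT (p : Laminar) (f : 𝓢(FourVec, ℂ)) : Tensor := fun μ ν =>
  ∫ X : (Submodule.span ℝ {p.2.1})ᗮ,
    Complex.exp (2 * Real.pi * Complex.I * (inner ℝ p.1 (X : Space) : ℂ)) *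
      defectT (X : Space) p.2.1 p.2.2 f μ ν

/-! ### Distributions of defects -/

/-- A distribution of non-spacelike defects in the weak-field limit, given by its expansion in laminar
plane waves: the amplitude distribution is the complex measure `weight • measure` on
the space of laminar plane waves of non-spacelike defects, of at most polynomial growth in the wave
vector. The density of defects on the set of states `(X, d, v)` is
`ρ(X, d, v) = ∫ exp (2πi k·X) weight (k, d, v) dk`. -/
structure Distribution where
  measure : Measure Laminar
  sigmaFinite : SigmaFinite measure
  weight : Laminar → ℂ
  tempered : ∃ N : ℕ, Integrable (fun p => (((1 + ‖p.1‖) ^ N : ℝ) : ℂ)⁻¹ * weight p) measure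
  physical : ∀ᵐ p ∂measure, IsPhysical p

/-- The energy density is real: the amplitude distribution takes complex conjugate values
at `k` and `-k`. -/
def Distribution.IsReal (C : Distribution) : Prop :=
  ∀ (R : ℝ) (B : Set Laminar), MeasurableSet B → (∀ p ∈ B, ‖p.1‖ ≤ R) →
    ∫ p in {p : Laminar | (-p.1, p.2) ∈ B}, C.weight p ∂C.measure =
      (starRingEnd ℂ) (∫ p in B, C.weight p ∂C.measure)

/-- The energy--momentum tensor of a distribution of defects, obtained by adding
those of its constituents; a tensor-valued distribution, evaluated on a test function `f`. -/
def Distribution.T (C : Distribution) (f : 𝓢(FourVec, ℂ)) : Tensor := fun μ ν =>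
  ∫ p, C.weight p * laminarT p f μ ν ∂C.measure

/-- `T_{μν}(k)`, as a density with respect to the measure `m` on wave vectors, is the Fourier
transform of the energy--momentum tensor of `C`:
`T_{μν}(x) = ∫ T_{μν}(k) exp (2πi k·x) m(dk)` in the sense of tempered distributions. -/
def Distribution.HasFourier (C : Distribution) (m : Measure FourVec) (T : FourVec → Tensor) :
    Prop :=
  (∀ μ ν, ∃ N : ℕ, Integrable (fun k => (((1 + ‖k‖) ^ N : ℝ) : ℂ)⁻¹ * T k μ ν) m) ∧
  ∀ (f : 𝓢(FourVec, ℂ)) (μ ν : Fin 4),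
    C.T f μ ν = ∫ k, T k μ ν * (∫ x, wave k x * f x) ∂m

/-- The restrictions on the value `T` of the Fourier transform at the wave vector `k`. -/
structure Restrictions (k : FourVec) (T : Tensor) : Prop where
  conserved : ∀ ν, contract k T ν = 0
  timelike : IsTimelike k → T = 0
  lightlike : IsLightlike k → ∀ l : FourVec, IsLightlike l → IsNonSpacelike (contract l T)

/-! ### The natural measures on the laminar plane waves with a given wave vector -/

/-- The surface measure of the unit sphere of a subspace. -/
def sphereMeasure (W : Submodule ℝ Space) : Measure Space :=
  Measure.map (fun d : Metric.sphere (0 : W) 1 => ((d : W) : Space)) (volume : Measure W).toSphere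

/-- The laminar plane wave with four-wave-vector `k = (ω, k)` (with nonzero spatial part), direction
`d ⊥ k` and perpendicular velocity parameter `v`: its velocity is
`ω k / |k|² + v (k × d) / |k|²`. -/
def laminarOf (k : FourVec) (q : Space × ℝ) : Laminar :=
  (spatial k, q.1,
    (k 0 / ‖spatial k‖ ^ 2) • spatial k +
      (q.2 / ‖spatial k‖ ^ 2) • WithLp.toLp 2 (crossProduct (spatial k).ofLp q.1.ofLp))

/-- The measure `dd dv` on the laminar plane waves of non-spacelike defects with four-wave-vector `k`;
`d` runs over the unit circle orthogonal to the spatial part of `k`, and `v² ≤ k_μ k^μ`. -/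
def fibreMeasure (k : FourVec) : Measure Laminar :=
  Measure.map (laminarOf k)
    ((sphereMeasure (Submodule.span ℝ {spatial k})ᗮ).prod
      (volume.restrict (Set.Icc (-√(mink k k)) (√(mink k k)))))

/-- The homogeneous wave (wave vector zero) with direction `d` at spherical angles `(θ, φ)`
and velocity `a e_θ + b e_φ` orthogonal to `d`; the arguments are `(θ, φ, a, b)`. -/
def homogeneousOf (q : ℝ × ℝ × ℝ × ℝ) : Laminar :=
  (0, !₂[Real.sin q.1 * Real.cos q.2.1, Real.sin q.1 * Real.sin q.2.1, Real.cos q.1],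
    q.2.2.1 • !₂[Real.cos q.1 * Real.cos q.2.1, Real.cos q.1 * Real.sin q.2.1, -Real.sin q.1] +
      q.2.2.2 • !₂[-Real.sin q.2.1, Real.cos q.2.1, 0])

/-- The measure `dd dv` on the homogeneous waves of non-spacelike defects: surface measure
`sin θ dθ dφ` on directions `d` and Lebesgue measure on the disc `|v| ≤ 1`, `v ⊥ d`. -/
def homogeneousMeasure : Measure Laminar :=
  Measure.map homogeneousOf
    ((volume.restrict {q : ℝ × ℝ × ℝ × ℝ | q.1 ∈ Set.Icc 0 Real.pi ∧
        q.2.1 ∈ Set.Icc 0 (2 * Real.pi) ∧ q.2.2.1 ^ 2 + q.2.2.2 ^ 2 ≤ 1}).withDensity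
      (fun q => ENNReal.ofReal (Real.sin q.1)))

/-- The measure `dd dv` on the laminar plane waves with four-wave-vector `k`. -/
def modeMeasure (k : FourVec) : Measure Laminar :=
  open Classical in if k = 0 then homogeneousMeasure else fibreMeasure k

end LineDefect

end

noncomputable section

namespace LineDefect

open scoped FourierTransform ContDiff

/-! The phase of a laminar plane wave is constant along each world sheet: the four-wave-vector
`(k·v, k)` is Minkowski-orthogonal to both `u` and `d`. Since `(X, t, s) ↦ (t, X + t v + s d)`
preserves volume, the energy–momentum tensor of the wave is the constant sheet tensor times the
plane wave with that wave vector (`laminarT_eq`). A distribution of defects is thus, in Fourier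
space, the push-forward of its amplitude under `fourWave`, weighted by sheet tensors.

Restrictions. Each is a linear relation, with smooth coefficients, between the components of the
sheet tensor, valid for waves whose wave vector lies on the zero set of a smooth function. Testing
against smooth compactly supported functions multiplied by `exp (-n φ²)` and letting `n → ∞` carries
such a relation to every Fourier transform (`ae_sum_eq_zero`). For timelike `k` there are no waves,
because `|k·v| ≤ |k|`. For lightlike `k`, equality in Cauchy–Schwarz forces the defects to move at
light speed along `k`, so the sheet tensor is a multiple of `k_μ k_ν` and all its contractions are
null. A Fourier transform exists by disintegrating the push-forward over `k` (`exists_hasFourier`).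

Converse. The superpositions of sheet tensors with continuous weight form a linear space. If `φ`
annihilates it, the weight `conj (φ S)` gives `∫ |φ S|² = 0`, so `φ` vanishes on almost every sheet
tensor (`exists_continuous_weight`), hence by continuity on all those of the mode. Evaluating the
quadratic form `x ↦ φ (dyad x x)` on static or slowest defects and on defects at light speed shows
that it vanishes on all `x` orthogonal to `k`. By polarisation `φ` kills every conserved symmetric
tensor, so each such tensor is a superposition. A real mode comes from a weight made
conjugation-symmetric under `k ↦ -k`. -/

/-! ### The Fourier transform of a laminar plane wave -/

/-- The integral of a test function against a plane wave. -/
def waveTransform (f : FourVec → ℂ) (k : FourVec) : ℂ := ∫ x, wave k x * f x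

/-- The four-wave-vector of a laminar plane wave. -/
def fourWave (p : Laminar) : FourVec := fourVec (inner ℝ p.1 p.2.2) p.1

lemma inner_space (x y : Space) : inner ℝ x y = x 0 * y 0 + x 1 * y 1 + x 2 * y 2 := by
  simp [PiLp.inner_apply, Fin.sum_univ_three]; ring

lemma mink_eq (k x : FourVec) :
    mink k x = -(k 0 * x 0) + k 1 * x 1 + k 2 * x 2 + k 3 * x 3 := by
  simp [mink, Fin.sum_univ_four, eta]

lemma mink_fourVec (s t : ℝ) (x y : Space) :
    mink (fourVec s x) (fourVec t y) = -(s * t) + inner ℝ x y := by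
  rw [mink_eq, inner_space]; simp [fourVec]; ring

@[fun_prop]
lemma continuous_fourVec : Continuous (fun q : ℝ × Space => fourVec q.1 q.2) := by
  unfold fourVec; fun_prop

@[fun_prop]
lemma continuous_fourWave : Continuous fourWave := by
  unfold fourWave
  exact continuous_fourVec.comp (by fun_prop : Continuous fun p : Laminar =>
    ((inner ℝ p.1 p.2.2 : ℝ), p.1))

@[fun_prop]
lemma continuous_sheetTensor : Continuous (fun q : Space × Space => sheetTensor q.1 q.2) := by
  have h1 : Continuous fun q : Space × Space => fourVec 1 q.2 :=
    continuous_fourVec.comp (by fun_prop : Continuous fun q : Space × Space => ((1 : ℝ), q.2))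
  have h2 : Continuous fun q : Space × Space => fourVec 0 q.1 :=
    continuous_fourVec.comp (by fun_prop : Continuous fun q : Space × Space => ((0 : ℝ), q.1))
  unfold sheetTensor lower mink
  refine continuous_pi fun μ => continuous_pi fun ν => ?_
  fun_prop

lemma continuous_wave (k : FourVec) : Continuous (wave k) := by
  unfold wave mink; fun_prop

lemma norm_wave (k x : FourVec) : ‖wave k x‖ = 1 := by
  unfold wave
  rw [show (2 * Real.pi * Complex.I * (mink k x : ℂ)) = ((2 * Real.pi * mink k x : ℝ) : ℂ) * Complex.I by
    push_cast; ring]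
  exact Complex.norm_exp_ofReal_mul_I _

lemma measurePreserving_fourVec :
    MeasurePreserving (fun q : ℝ × Space => fourVec q.1 q.2) volume volume := by
  have h1 : MeasurePreserving (Prod.map id (WithLp.ofLp : Space → Fin 3 → ℝ))
      (volume : Measure (ℝ × Space)) (volume : Measure (ℝ × (Fin 3 → ℝ))) :=
    (MeasurePreserving.id volume).prod (PiLp.volume_preserving_ofLp (Fin 3))
  have h2 := (volume_preserving_piFinSuccAbove (fun _ : Fin 4 => ℝ) 0).symm
  have h3 := (PiLp.volume_preserving_toLp (Fin 4)).comp (h2.comp h1)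
  have e : (fun q : ℝ × Space => fourVec q.1 q.2) = WithLp.toLp 2 ∘
      (MeasurableEquiv.piFinSuccAbove (fun _ : Fin 4 => ℝ) 0).symm ∘
        Prod.map id (WithLp.ofLp : Space → Fin 3 → ℝ) := by
    funext q
    ext i
    fin_cases i <;> rfl
  rw [e]
  exact h3

lemma measurePreserving_add_smul {d : Space} (hd : ‖d‖ = 1) :
    MeasurePreserving (fun q : (Submodule.span ℝ {d})ᗮ × ℝ => (q.1 : Space) + q.2 • d)
      volume volume := by
  have h1 : MeasurePreserving (Prod.map (LinearIsometryEquiv.toSpanUnitSingleton d hd) id)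
      (volume : Measure (ℝ × (Submodule.span ℝ {d})ᗮ)) volume :=
    (LinearIsometryEquiv.measurePreserving _).prod (MeasurePreserving.id volume)
  have h2 := (Submodule.orthogonalDecomposition (𝕜 := ℝ) (Submodule.span ℝ {d})).symm.measurePreserving
  have h3 := h2.comp ((WithLp.volume_preserving_toLp _ _).comp
    (h1.comp (Measure.measurePreserving_swap (μ := (volume : Measure (Submodule.span ℝ {d})ᗮ))
      (ν := (volume : Measure ℝ)))))
  have e : (fun q : (Submodule.span ℝ {d})ᗮ × ℝ => (q.1 : Space) + q.2 • d) =
      (Submodule.span ℝ {d}).orthogonalDecomposition.symm ∘ WithLp.toLp 2 ∘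
        Prod.map (LinearIsometryEquiv.toSpanUnitSingleton d hd) id ∘ Prod.swap := by
    funext q
    simp [add_comm]
  rw [e]
  exact h3

/-- At fixed `t` the orthogonal splitting of space along `d` is an isometry and the motion only adds
the translation `t • v`, so the map is a shear of a volume-preserving map. -/
lemma measurePreserving_worldSheet {d : Space} (hd : ‖d‖ = 1) (v : Space) :
    MeasurePreserving (fun q : (Submodule.span ℝ {d})ᗮ × (ℝ × ℝ) =>
      fourVec q.2.1 ((q.1 : Space) + q.2.1 • v + q.2.2 • d)) volume volume := by
  have h0 : MeasurePreserving (fun q : (Submodule.span ℝ {d})ᗮ × (ℝ × ℝ) => (q.2.1, (q.1, q.2.2)))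
      volume volume := by
    have a1 := (measurePreserving_prodAssoc (volume : Measure (Submodule.span ℝ {d})ᗮ)
      (volume : Measure ℝ) (volume : Measure ℝ)).symm
    have a2 : MeasurePreserving (Prod.map Prod.swap id) ((volume.prod volume).prod volume) _ :=
      (Measure.measurePreserving_swap (μ := (volume : Measure (Submodule.span ℝ {d})ᗮ))
      (ν := (volume : Measure ℝ))).prod (MeasurePreserving.id (volume : Measure ℝ))
    have a3 := (measurePreserving_prodAssoc (volume : Measure ℝ) (volume : Measure (Submodule.span ℝ {d})ᗮ)
      (volume : Measure ℝ))
    exact a3.comp (a2.comp a1)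
  have h1 : MeasurePreserving (fun q : ℝ × ((Submodule.span ℝ {d})ᗮ × ℝ) =>
      (q.1, ((q.2.1 : Space) + q.2.2 • d) + q.1 • v)) volume volume := by
    refine MeasurePreserving.skew_product (g := fun t (q : (Submodule.span ℝ {d})ᗮ × ℝ) =>
      ((q.1 : Space) + q.2 • d) + t • v) (MeasurePreserving.id volume) ?_ ?_
    · exact Continuous.measurable (by fun_prop)
    · exact Filter.Eventually.of_forall fun t =>
        ((measurePreserving_add_right volume (t • v)).comp (measurePreserving_add_smul hd)).map_eq
  convert measurePreserving_fourVec.comp (h1.comp h0) using 1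
  ext q : 1
  simp [add_right_comm]

lemma integrable_wave_mul (k : FourVec) (f : 𝓢(FourVec, ℂ)) :
    Integrable (fun x => wave k x * f x) := by
  refine (f.integrable (μ := volume)).bdd_mul (continuous_wave k).aestronglyMeasurable
    (c := 1) (Filter.Eventually.of_forall fun x => (norm_wave k x).le)

/-- The three integrations over `X`, `t` and `s` together are one integral over spacetime in
world-sheet coordinates, by Fubini. -/
lemma laminarT_eq {p : Laminar} (hp : IsPhysical p) (f : 𝓢(FourVec, ℂ)) (μ ν : Fin 4) :
    laminarT p f μ ν = sheetTensor p.2.1 p.2.2 μ ν * waveTransform f (fourWave p) := by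
  obtain ⟨k, d, v⟩ := p
  obtain ⟨hd, hkd, hvd, -⟩ := hp
  simp only at hd hkd hvd ⊢
  have hM := measurePreserving_worldSheet hd v
  have hint := integrable_wave_mul (fourWave (k, d, v)) f
  have hint' := hM.integrable_comp_of_integrable hint
  have hI : waveTransform f (fourWave (k, d, v)) =
      ∫ q : (Submodule.span ℝ {d})ᗮ × (ℝ × ℝ),
        wave (fourWave (k, d, v)) (fourVec q.2.1 ((q.1 : Space) + q.2.1 • v + q.2.2 • d)) *
          f (fourVec q.2.1 ((q.1 : Space) + q.2.1 • v + q.2.2 • d)) := by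
    unfold waveTransform
    rw [← hM.map_eq, integral_map hM.measurable.aemeasurable]
    rw [hM.map_eq]; exact hint.aestronglyMeasurable
  -- The terms in `t` cancel because the frequency is `k·v`; the term in `s` vanishes because `k ⊥
  -- d`.
  have hphase : ∀ q : (Submodule.span ℝ {d})ᗮ × (ℝ × ℝ),
      wave (fourWave (k, d, v)) (fourVec q.2.1 ((q.1 : Space) + q.2.1 • v + q.2.2 • d)) =
        Complex.exp (2 * Real.pi * Complex.I * (inner ℝ k (q.1 : Space) : ℂ)) := by
    intro q
    have : mink (fourWave (k, d, v)) (fourVec q.2.1 ((q.1 : Space) + q.2.1 • v + q.2.2 • d)) =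
        inner ℝ k (q.1 : Space) := by
      unfold fourWave
      rw [mink_fourVec]
      simp only [inner_add_right, inner_smul_right, hkd]
      ring
    rw [wave, this]
  simp only [hphase] at hI
  unfold laminarT defectT
  simp only [Matrix.smul_apply, smul_eq_mul]
  have hint2 : Integrable (fun q : (Submodule.span ℝ {d})ᗮ × (ℝ × ℝ) =>
      Complex.exp (2 * Real.pi * Complex.I * (inner ℝ k (q.1 : Space) : ℂ)) *
          f (fourVec q.2.1 ((q.1 : Space) + q.2.1 • v + q.2.2 • d))) (volume.prod volume) := by
    refine hint'.congr (Filter.Eventually.of_forall fun q => ?_)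
    simp only [Function.comp, hphase]
  rw [hI, ← integral_const_mul, Measure.volume_eq_prod, integral_prod _ (hint2.const_mul _)]
  refine integral_congr_ae ?_
  filter_upwards [hint2.prod_right_ae] with X hX
  rw [Measure.volume_eq_prod] at hX ⊢
  rw [integral_const_mul, integral_prod _ hX]
  simp only [integral_const_mul]
  ring

/-! ### Index lowering and the Fourier transform in Minkowski form -/

/-- Lowering the index, as a linear isometry of coordinate four-space. -/
def lowerIsometry : FourVec ≃ₗᵢ[ℝ] FourVec where
  toFun k := WithLp.toLp 2 (lower k)
  invFun k := WithLp.toLp 2 (lower k)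
  map_add' x y := by ext i; simp [lower, mul_add]
  map_smul' c x := by ext i; simp [lower]; ring
  left_inv x := by ext i; by_cases h : i = 0 <;> simp [lower, eta, h]
  right_inv x := by ext i; by_cases h : i = 0 <;> simp [lower, eta, h]
  norm_map' x := by
    simp [EuclideanSpace.norm_eq, lower, eta, Fin.sum_univ_four]

lemma lowerIsometry_lowerIsometry (k : FourVec) : lowerIsometry (lowerIsometry k) = k :=
  lowerIsometry.symm_apply_apply k

lemma inner_lowerIsometry (k x : FourVec) : inner ℝ x (lowerIsometry k) = mink k x := by
  simp [PiLp.inner_apply, mink, lowerIsometry, lower]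

/-- Lowering the index turns the Minkowski phase into a Euclidean one, so Schwartz-space Fourier
theory applies. -/
lemma waveTransform_eq (f : 𝓢(FourVec, ℂ)) (k : FourVec) :
    waveTransform f k = (𝓕⁻ f) (lowerIsometry k) := by
  rw [SchwartzMap.fourierInv_coe, Real.fourierInv_eq']
  refine integral_congr_ae (Filter.Eventually.of_forall fun x => ?_)
  simp only [smul_eq_mul, wave, inner_lowerIsometry]
  congr 2
  push_cast
  ring

lemma continuous_waveTransform (f : 𝓢(FourVec, ℂ)) : Continuous (waveTransform f) := by
  simp_rw [funext (waveTransform_eq f)]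
  fun_prop

/-- Fourier inversion: identities tested on Schwartz functions of `x` may be tested on arbitrary
bump functions of `k`. -/
lemma exists_waveTransform_eq {g : FourVec → ℂ} (hg : ContDiff ℝ ∞ g) (hc : HasCompactSupport g) :
    ∃ f : 𝓢(FourVec, ℂ), waveTransform f = g := by
  have h1 : HasCompactSupport (g ∘ lowerIsometry) :=
    hc.comp_isClosedEmbedding lowerIsometry.toHomeomorph.isClosedEmbedding
  have h2 : ContDiff ℝ ∞ (g ∘ lowerIsometry) := hg.comp lowerIsometry.contDiff
  refine ⟨𝓕 (h1.toSchwartzMap h2), funext fun k => ?_⟩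
  rw [waveTransform_eq, FourierTransform.fourierInv_fourier_eq]
  simp [lowerIsometry_lowerIsometry]

/-- A function on wave space decaying faster than any power. -/
def RapidDecay (G : FourVec → ℂ) : Prop := ∀ N : ℕ, ∃ B : ℝ, ∀ k, (1 + ‖k‖) ^ N * ‖G k‖ ≤ B

lemma rapidDecay_waveTransform (f : 𝓢(FourVec, ℂ)) : RapidDecay (waveTransform f) := by
  intro N
  refine ⟨2 ^ N * ((Finset.Iic (N, 0)).sup fun m => SchwartzMap.seminorm ℝ m.1 m.2) (𝓕⁻ f),
    fun k => ?_⟩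
  have := SchwartzMap.one_add_le_sup_seminorm_apply (𝕜 := ℝ) (m := (N, 0)) (k := N) (n := 0) le_rfl le_rfl
    (𝓕⁻ f) (lowerIsometry k)
  rw [norm_iteratedFDeriv_zero, LinearIsometryEquiv.norm_map, ← waveTransform_eq] at this
  exact this

lemma HasCompactSupport.rapidDecay {G : FourVec → ℂ} (hG : Continuous G) (hc : HasCompactSupport G) :
    RapidDecay G := by
  intro N
  have h : Continuous fun k : FourVec => (((1 + ‖k‖) ^ N : ℝ) : ℂ) * G k := by fun_prop
  obtain ⟨B, hB⟩ := h.bounded_above_of_compact_support hc.mul_left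
  refine ⟨B, fun k => ?_⟩
  have := hB k
  rwa [norm_mul, Complex.norm_real, Real.norm_of_nonneg (by positivity)] at this

/-! ### Boundedness and integrability -/

lemma norm_le_norm_fourVec (t : ℝ) (x : Space) : ‖x‖ ≤ ‖fourVec t x‖ := by
  rw [EuclideanSpace.norm_eq, EuclideanSpace.norm_eq]
  refine Real.sqrt_le_sqrt ?_
  simp only [Fin.sum_univ_four, Fin.sum_univ_three]
  simp [fourVec]
  nlinarith [sq_nonneg t]

/-- Physical directions and velocities lie in a compact set; only the wave vector is unbounded. -/
lemma exists_norm_le_of_isPhysical {F : Space × Space → ℂ} (hF : Continuous F) :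
    ∃ B : ℝ, 0 ≤ B ∧ ∀ p, IsPhysical p → ‖F p.2‖ ≤ B := by
  have hK : IsCompact (Metric.closedBall (0 : Space) 1 ×ˢ Metric.closedBall (0 : Space) 1) :=
    (isCompact_closedBall _ _).prod (isCompact_closedBall _ _)
  obtain ⟨B, hB⟩ := hK.exists_bound_of_continuousOn hF.continuousOn
  refine ⟨max B 0, le_max_right _ _, fun p hp => (hB p.2 ?_).trans (le_max_left _ _)⟩
  simp [hp.1.le, hp.2.2.2]

lemma continuous_sheetTensor_apply (μ ν : Fin 4) :
    Continuous fun q : Space × Space => sheetTensor q.1 q.2 μ ν :=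
  (continuous_apply ν).comp ((continuous_apply μ).comp continuous_sheetTensor)

lemma Distribution.aestronglyMeasurable_weight (C : Distribution) :
    AEStronglyMeasurable C.weight C.measure := by
  obtain ⟨N, hN⟩ := C.tempered
  have h : Continuous fun p : Laminar => (((1 + ‖p.1‖) ^ N : ℝ) : ℂ) := by fun_prop
  refine (h.aestronglyMeasurable.mul hN.aestronglyMeasurable).congr
    (Filter.Eventually.of_forall fun p => ?_)
  have : (((1 + ‖p.1‖) ^ N : ℝ) : ℂ) ≠ 0 := by
    exact_mod_cast (by positivity : (1 + ‖p.1‖) ^ N ≠ 0)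
  simp only [Pi.mul_apply]
  rw [mul_inv_cancel_left₀ this]

lemma Distribution.exists_integrable (C : Distribution) : ∃ N : ℕ,
    Integrable (fun p => (((1 + ‖fourWave p‖) ^ N : ℝ) : ℂ)⁻¹ * C.weight p) C.measure := by
  obtain ⟨N, hN⟩ := C.tempered
  refine ⟨N, hN.mono ?_ (Filter.Eventually.of_forall fun p => ?_)⟩
  · refine AEStronglyMeasurable.mul ?_ C.aestronglyMeasurable_weight
    have h : Measurable fun p : Laminar => (((1 + ‖fourWave p‖) ^ N : ℝ) : ℂ) :=
      Continuous.measurable (by fun_prop)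
    exact h.inv.aestronglyMeasurable
  · rw [norm_mul, norm_mul, norm_inv, norm_inv, Complex.norm_real, Complex.norm_real,
      Real.norm_of_nonneg (by positivity), Real.norm_of_nonneg (by positivity)]
    gcongr
    exact norm_le_norm_fourVec _ _

lemma Distribution.integrable_pairing (C : Distribution) {F : Space × Space → ℂ} (hF : Continuous F)
    {G : FourVec → ℂ} (hG : Continuous G) (hd : RapidDecay G) :
    Integrable (fun p => C.weight p * (F p.2 * G (fourWave p))) C.measure := by
  obtain ⟨N, hN⟩ := C.exists_integrable
  obtain ⟨B, hB0, hB⟩ := exists_norm_le_of_isPhysical hF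
  obtain ⟨D, hD⟩ := hd N
  have h : Continuous fun p : Laminar =>
      (((1 + ‖fourWave p‖) ^ N : ℝ) : ℂ) * (F p.2 * G (fourWave p)) := by fun_prop
  refine (hN.bdd_mul h.aestronglyMeasurable (c := B * D) ?_).congr
    (Filter.Eventually.of_forall fun p => ?_)
  · filter_upwards [C.physical] with p hp
    rw [norm_mul, norm_mul, Complex.norm_real, Real.norm_of_nonneg (by positivity)]
    calc _ = ‖F p.2‖ * ((1 + ‖fourWave p‖) ^ N * ‖G (fourWave p)‖) := by ring
      _ ≤ _ := by gcongr; exacts [hB p hp, hD _]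
  · have : (((1 + ‖fourWave p‖) ^ N : ℝ) : ℂ) ≠ 0 := by
      exact_mod_cast (by positivity : (1 + ‖fourWave p‖) ^ N ≠ 0)
    simp only
    field_simp

lemma Distribution.T_eq (C : Distribution) (f : 𝓢(FourVec, ℂ)) (μ ν : Fin 4) :
    C.T f μ ν = ∫ p, C.weight p * (sheetTensor p.2.1 p.2.2 μ ν * waveTransform f (fourWave p))
      ∂C.measure := by
  refine integral_congr_ae ?_
  filter_upwards [C.physical] with p hp
  rw [laminarT_eq hp]

/-! ### Comparison of a distribution with its Fourier transform -/

section HasFourier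

variable {C : Distribution} {m : Measure FourVec} {T : FourVec → Tensor}

lemma Distribution.HasFourier.integral_mul_eq (h : C.HasFourier m T) {g : FourVec → ℂ}
    (hg : ContDiff ℝ ∞ g) (hc : HasCompactSupport g) (μ ν : Fin 4) :
    ∫ k, T k μ ν * g k ∂m =
      ∫ p, C.weight p * (sheetTensor p.2.1 p.2.2 μ ν * g (fourWave p)) ∂C.measure := by
  obtain ⟨f, rfl⟩ := exists_waveTransform_eq hg hc
  rw [← C.T_eq]
  exact (h.2 f μ ν).symm

lemma Distribution.HasFourier.locallyIntegrable (h : C.HasFourier m T) {c : FourVec → ℂ}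
    (hc : Continuous c) (μ ν : Fin 4) : LocallyIntegrable (fun k => c k * T k μ ν) m := by
  obtain ⟨N, hN⟩ := h.1 μ ν
  have hc' : Continuous fun k : FourVec => c k * (((1 + ‖k‖) ^ N : ℝ) : ℂ) := by fun_prop
  have := (locallyIntegrableOn_univ.2 hN.locallyIntegrable).continuousOn_mul
    hc'.continuousOn isOpen_univ.isLocallyClosed
  rw [locallyIntegrableOn_univ] at this
  convert this using 2 with k
  have : (((1 + ‖k‖) ^ N : ℝ) : ℂ) ≠ 0 := by
    exact_mod_cast (by positivity : (1 + ‖k‖) ^ N ≠ 0)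
  field_simp

/-- A linear relation with smooth coefficients between the components of the sheet tensor that holds
for the waves whose wave vector lies on the zero set of `φ` holds for the Fourier transform there. -/
lemma Distribution.HasFourier.ae_sum_eq_zero (h : C.HasFourier m T)
    {c : Fin 4 × Fin 4 → FourVec → ℝ} (hc : ∀ i, ContDiff ℝ ∞ (c i)) {φ : FourVec → ℝ}
    (hφ : ContDiff ℝ ∞ φ)
    (hS : ∀ p, IsPhysical p → φ (fourWave p) = 0 →
      ∑ i, (c i (fourWave p) : ℂ) * sheetTensor p.2.1 p.2.2 i.1 i.2 = 0) :
    ∀ᵐ k ∂m, φ k = 0 → ∑ i, (c i k : ℂ) * T k i.1 i.2 = 0 := by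
  set H : FourVec → ℂ := fun k => ∑ i, (c i k : ℂ) * T k i.1 i.2 with hH
  have hcc : ∀ i, Continuous fun k => (c i k : ℂ) := fun i =>
    Complex.continuous_ofReal.comp (hc i).continuous
  have hHloc : LocallyIntegrable H m := by
    have := locallyIntegrable_finsetSum (μ := m) (Finset.univ : Finset (Fin 4 × Fin 4))
      (f := fun i k => (c i k : ℂ) * T k i.1 i.2) (fun i _ => h.locallyIntegrable (hcc i) i.1 i.2)
    exact this
  have hZ : MeasurableSet {k | φ k = 0} := hφ.continuous.measurable (measurableSet_singleton 0)
  have hzero : ∀ᵐ k ∂m, {k | φ k = 0}.indicator H k = 0 := by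
    refine ae_eq_zero_of_integral_contDiff_smul_eq_zero (hHloc.indicator hZ) fun g hg hgc => ?_
    have hHg : Integrable (fun k => g k • H k) m :=
      hHloc.integrable_smul_left_of_hasCompactSupport hg.continuous hgc
    -- Smooth functions bounded by `1` that converge pointwise to the indicator of the zero set of
    -- `φ`; the indicator itself is not an admissible test function.
    let e : ℕ → FourVec → ℝ := fun n k => Real.exp (-(n * φ k ^ 2))
    have he : ∀ n, ContDiff ℝ ∞ (e n) := fun n => by fun_prop
    have he1 : ∀ n k, ‖e n k‖ ≤ 1 := fun n k => by
      rw [Real.norm_of_nonneg (Real.exp_pos _).le, Real.exp_le_one_iff]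
      exact neg_nonpos.2 (by positivity)
    have helim : ∀ k, Filter.Tendsto (fun n => e n k) Filter.atTop
        (nhds ({k | φ k = 0}.indicator 1 k)) := by
      intro k
      by_cases hk : φ k = 0
      · simp [e, hk]
      · rw [Set.indicator_of_notMem (by simpa using hk)]
        refine Real.tendsto_exp_atBot.comp (Filter.tendsto_neg_atTop_atBot.comp ?_)
        exact tendsto_natCast_atTop_atTop.atTop_mul_const (by positivity)
    let G : ℕ → Fin 4 × Fin 4 → FourVec → ℂ := fun n i k => ((c i k * (g k * e n k) : ℝ) : ℂ)
    have hG : ∀ n i, ContDiff ℝ ∞ (G n i) := fun n i =>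
      Complex.ofRealCLM.contDiff.comp ((hc i).mul (hg.mul (he n)))
    have hGc : ∀ n i, HasCompactSupport (G n i) := fun n i =>
      HasCompactSupport.comp_left (g := fun x : ℝ => (x : ℂ)) (hgc.mul_right.mul_left) (by simp)
    have hGT : ∀ n i, Integrable (fun k => T k i.1 i.2 * G n i k) m := fun n i => by
      have := (h.locallyIntegrable (c := fun _ => 1) continuous_const i.1 i.2)
        |>.integrable_smul_left_of_hasCompactSupport (hG n i).continuous (hGc n i)
      refine this.congr (Filter.Eventually.of_forall fun k => ?_)
      simp [mul_comm]
    have hGS : ∀ n i, Integrable (fun p => C.weight p *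
        (sheetTensor p.2.1 p.2.2 i.1 i.2 * G n i (fourWave p))) C.measure := fun n i =>
      C.integrable_pairing (continuous_sheetTensor_apply i.1 i.2) (hG n i).continuous
        (HasCompactSupport.rapidDecay (hG n i).continuous (hGc n i))
    have key : ∀ n, ∫ k, e n k • (g k • H k) ∂m = ∫ p, e n (fourWave p) • (C.weight p *
        (g (fourWave p) * ∑ i, (c i (fourWave p) : ℂ) * sheetTensor p.2.1 p.2.2 i.1 i.2))
        ∂C.measure := by
      intro n
      calc _ = ∫ k, ∑ i, T k i.1 i.2 * G n i k ∂m := by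
            refine integral_congr_ae (Filter.Eventually.of_forall fun k => ?_)
            simp only [hH, G, Complex.real_smul, Finset.mul_sum]
            refine Finset.sum_congr rfl fun i _ => ?_
            push_cast
            ring
        _ = ∑ i, ∫ k, T k i.1 i.2 * G n i k ∂m := integral_finsetSum _ fun i _ => hGT n i
        _ = ∑ i : Fin 4 × Fin 4, ∫ p, C.weight p *
              (sheetTensor p.2.1 p.2.2 i.1 i.2 * G n i (fourWave p)) ∂C.measure :=
            Finset.sum_congr rfl fun i _ => h.integral_mul_eq (hG n i) (hGc n i) i.1 i.2
        _ = ∫ p, ∑ i : Fin 4 × Fin 4, C.weight p *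
              (sheetTensor p.2.1 p.2.2 i.1 i.2 * G n i (fourWave p)) ∂C.measure :=
            (integral_finsetSum _ fun i _ => hGS n i).symm
        _ = _ := by
            refine integral_congr_ae (Filter.Eventually.of_forall fun p => ?_)
            simp only [G, Complex.real_smul, Finset.mul_sum]
            refine Finset.sum_congr rfl fun i _ => ?_
            push_cast
            ring
    have hR : Integrable (fun p => C.weight p * (g (fourWave p) *
        ∑ i, (c i (fourWave p) : ℂ) * sheetTensor p.2.1 p.2.2 i.1 i.2)) C.measure := by
      have := integrable_finsetSum (μ := C.measure) (Finset.univ : Finset (Fin 4 × Fin 4))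
        fun i _ => hGS 0 i
      refine this.congr (Filter.Eventually.of_forall fun p => ?_)
      simp only [G, e, Finset.mul_sum, Nat.cast_zero, zero_mul, neg_zero, Real.exp_zero, mul_one]
      refine Finset.sum_congr rfl fun i _ => ?_
      push_cast
      ring
    have hl := tendsto_integral_of_dominated_convergence (μ := m) (F := fun n k => e n k • (g k • H k))
      (f := fun k => {k | φ k = 0}.indicator (1 : FourVec → ℝ) k • (g k • H k)) (fun k => ‖g k • H k‖)
      (fun n => (he n).continuous.aestronglyMeasurable.smul hHg.aestronglyMeasurable) hHg.norm
      (fun n => Filter.Eventually.of_forall fun k => by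
        rw [norm_smul]
        exact mul_le_of_le_one_left (norm_nonneg _) (he1 n k))
      (Filter.Eventually.of_forall fun k => (helim k).smul_const _)
    have hr := tendsto_integral_of_dominated_convergence (μ := C.measure)
      (F := fun n p => e n (fourWave p) • (C.weight p *
        (g (fourWave p) * ∑ i, (c i (fourWave p) : ℂ) * sheetTensor p.2.1 p.2.2 i.1 i.2)))
      (f := fun p => {k | φ k = 0}.indicator (1 : FourVec → ℝ) (fourWave p) • (C.weight p *
        (g (fourWave p) * ∑ i, (c i (fourWave p) : ℂ) * sheetTensor p.2.1 p.2.2 i.1 i.2))) _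
      (fun n => ((he n).continuous.comp continuous_fourWave).aestronglyMeasurable.smul
        hR.aestronglyMeasurable) hR.norm
      (fun n => Filter.Eventually.of_forall fun p => by
        rw [norm_smul]
        exact mul_le_of_le_one_left (norm_nonneg _) (he1 n _))
      (Filter.Eventually.of_forall fun p => (helim _).smul_const _)
    -- In the limit only waves on the zero set contribute, and there the relation holds by `hS`.
    have hr0 : ∫ p, {k | φ k = 0}.indicator (1 : FourVec → ℝ) (fourWave p) • (C.weight p *
        (g (fourWave p) * ∑ i, (c i (fourWave p) : ℂ) * sheetTensor p.2.1 p.2.2 i.1 i.2))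
        ∂C.measure = 0 := by
      refine integral_eq_zero_of_ae ?_
      filter_upwards [C.physical] with p hp
      by_cases hk : φ (fourWave p) = 0
      · simp [hS p hp hk]
      · simp [hk]
    rw [hr0] at hr
    simp_rw [key] at hl
    rw [← tendsto_nhds_unique hl hr]
    refine integral_congr_ae (Filter.Eventually.of_forall fun k => ?_)
    by_cases hk : φ k = 0 <;> simp [hk]
  filter_upwards [hzero] with k hk hk0
  rwa [Set.indicator_of_mem (by exact hk0)] at hk

end HasFourier

/-! ### The restrictions -/

lemma mink_self_fourWave (p : Laminar) :
    mink (fourWave p) (fourWave p) = ‖p.1‖ ^ 2 - (inner ℝ p.1 p.2.2) ^ 2 := by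
  unfold fourWave
  rw [mink_fourVec, real_inner_self_eq_norm_sq]
  ring

lemma mink_self_fourWave_nonneg {p : Laminar} (hp : IsPhysical p) :
    0 ≤ mink (fourWave p) (fourWave p) := by
  rw [mink_self_fourWave, sub_nonneg]
  refine sq_le_sq' ?_ ?_
  · have := neg_le_of_abs_le (abs_real_inner_le_norm p.1 p.2.2)
    nlinarith [norm_nonneg p.1, hp.2.2.2]
  · have := real_inner_le_norm p.1 p.2.2
    nlinarith [norm_nonneg p.1, hp.2.2.2]

lemma contract_sheetTensor (k : FourVec) (d v : Space) (ν : Fin 4) :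
    contract k (sheetTensor d v) ν = ((mink (fourVec 1 v) k * lower (fourVec 1 v) ν +
      mink (fourVec 1 v) (fourVec 1 v) * (mink (fourVec 0 d) k * lower (fourVec 0 d) ν) : ℝ) : ℂ) := by
  simp only [contract, sheetTensor, ← Complex.ofReal_mul, ← Complex.ofReal_sum]
  congr 1
  simp only [mink, lower, Finset.sum_mul, Finset.mul_sum, ← Finset.sum_add_distrib]
  simp only [Fin.sum_univ_four]
  ring

lemma contract_fourWave {p : Laminar} (hp : IsPhysical p) (ν : Fin 4) :
    contract (fourWave p) (sheetTensor p.2.1 p.2.2) ν = 0 := by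
  rw [contract_sheetTensor]
  have h1 : mink (fourVec 1 p.2.2) (fourWave p) = 0 := by
    unfold fourWave
    rw [mink_fourVec, real_inner_comm]; ring
  have h2 : mink (fourVec 0 p.2.1) (fourWave p) = 0 := by
    unfold fourWave
    rw [mink_fourVec, real_inner_comm p.1 p.2.1, hp.2.1]; ring
  simp [h1, h2]

lemma sheetTensor_zero_zero (d v : Space) : sheetTensor d v 0 0 = 1 := by
  simp [sheetTensor, lower, fourVec, eta]

/-- The lightlike waves consist of defects that move at the speed of light along the wave vector. -/
lemma sheetTensor_of_lightlike {p : Laminar} (hp : IsPhysical p)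
    (hk : mink (fourWave p) (fourWave p) = 0) (μ ν : Fin 4) :
    ((fourWave p 0 ^ 2 : ℝ) : ℂ) * sheetTensor p.2.1 p.2.2 μ ν =
      ((lower (fourWave p) μ * lower (fourWave p) ν : ℝ) : ℂ) := by
  obtain ⟨k, d, v⟩ := p
  obtain ⟨hd, hkd, hvd, hv⟩ := hp
  simp only at hd hkd hvd hv ⊢
  rw [mink_self_fourWave] at hk
  simp only at hk
  set w := (inner ℝ k v : ℝ) with hw
  have hle : |w| ≤ ‖k‖ * ‖v‖ := abs_real_inner_le_norm k v
  have habs : |w| = ‖k‖ := by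
    rw [← abs_of_nonneg (norm_nonneg k)]
    exact (sq_eq_sq_iff_abs_eq_abs _ _).1 (by linarith)
  by_cases hk0 : k = 0
  · have : w = 0 := by simp [hw, hk0]
    have hz : ∀ i, fourWave (k, d, v) i = 0 := by
      intro i
      fin_cases i <;> simp [fourWave, fourVec, hk0]
    simp [lower, hz]
  have hkpos : 0 < ‖k‖ := norm_pos_iff.2 hk0
  -- Now `|k| = |k·v| ≤ |k| |v|` with `|v| ≤ 1`: the equality case of Cauchy–Schwarz, so that `v` is
  -- a unit vector and `k = (k·v) v`.
  have hv1 : ‖v‖ = 1 := le_antisymm hv (by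
    rw [habs] at hle
    exact le_of_mul_le_mul_left (by linarith) hkpos)
  have hkv : k = w • v := by
    rw [← sub_eq_zero, ← norm_eq_zero, ← sq_eq_zero_iff, norm_sub_sq_real, inner_smul_right,
      norm_smul, hv1, ← hw, Real.norm_eq_abs, mul_one, sq_abs]
    linarith
  have hu : mink (fourVec 1 v) (fourVec 1 v) = 0 := by
    rw [mink_fourVec, real_inner_self_eq_norm_sq, hv1]; ring
  have hl : ∀ i, lower (fourWave (k, d, v)) i = w * lower (fourVec 1 v) i := by
    intro i
    have : fourWave (k, d, v) i = w * fourVec 1 v i := by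
      unfold fourWave
      simp only [← hw]
      conv_lhs => rw [hkv]
      fin_cases i <;> simp [fourVec]
    rw [lower, lower, this]; ring
  have h0 : fourWave (k, d, v) 0 = w := by simp [fourWave, fourVec, hw]
  rw [h0, hl, hl, sheetTensor, hu, ← Complex.ofReal_mul]
  congr 1
  ring

lemma contDiff_mink_self : ContDiff ℝ ∞ fun k : FourVec => mink k k := by
  unfold mink; fun_prop

section HasFourier

variable {C : Distribution} {m : Measure FourVec} {T : FourVec → Tensor}

lemma Distribution.HasFourier.ae_conserved (h : C.HasFourier m T) :
    ∀ᵐ k ∂m, ∀ ν, contract k (T k) ν = 0 := by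
  rw [ae_all_iff]
  intro ν
  have := h.ae_sum_eq_zero (c := fun i k => if i.2 = ν then k i.1 else 0) (φ := fun _ => 0)
    (fun i => by by_cases hi : i.2 = ν <;> simp only [hi, if_true, if_false] <;> fun_prop)
    contDiff_const (fun p hp _ => by
      simp only [Fintype.sum_prod_type, apply_ite Complex.ofReal, Complex.ofReal_zero, ite_mul,
        zero_mul, Finset.sum_ite_eq', Finset.mem_univ, if_true]
      exact contract_fourWave hp ν)
  filter_upwards [this] with k hk
  simpa only [contract, Fintype.sum_prod_type, apply_ite Complex.ofReal, Complex.ofReal_zero, ite_mul,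
        zero_mul, Finset.sum_ite_eq', Finset.mem_univ, if_true] using hk rfl

/-- The coefficient `expNegInvGlue (-k·k)` is smooth, positive exactly on timelike `k`, and zero at
the wave vector of every physical wave. So the relation "coefficient times component is zero" holds
trivially for waves and is informative for timelike `k`. -/
lemma Distribution.HasFourier.ae_timelike (h : C.HasFourier m T) :
    ∀ᵐ k ∂m, IsTimelike k → T k = 0 := by
  have hc : ContDiff ℝ ∞ fun k : FourVec => expNegInvGlue (-mink k k) :=
    expNegInvGlue.contDiff.comp contDiff_mink_self.neg
  have key : ∀ j : Fin 4 × Fin 4, ∀ᵐ k ∂m, IsTimelike k → T k j.1 j.2 = 0 := by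
    intro j
    have := h.ae_sum_eq_zero (c := fun i k => if i = j then expNegInvGlue (-mink k k) else 0)
      (φ := fun _ => 0)
      (fun i => by by_cases hi : i = j <;> simp only [hi, if_true, if_false] <;> fun_prop)
      contDiff_const (fun p hp _ => by
        rw [expNegInvGlue.zero_of_nonpos (neg_nonpos.2 (mink_self_fourWave_nonneg hp))]
        simp)
    filter_upwards [this] with k hk ht
    have hk := hk rfl
    simp only [apply_ite Complex.ofReal, Complex.ofReal_zero, ite_mul,
        zero_mul, Finset.sum_ite_eq', Finset.mem_univ, if_true, mul_eq_zero] at hk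
    refine hk.resolve_left ?_
    exact_mod_cast (expNegInvGlue.pos_of_pos (neg_pos.2 ht)).ne'
  filter_upwards [ae_all_iff.2 key] with k hk ht
  ext μ ν
  exact hk (μ, ν) ht

/-- Proportionality to `k_μ k_ν` is written without denominators, so that the coefficients are
polynomial; the factor is read off from the `00`-component, which is `1` for each sheet tensor. -/
lemma Distribution.HasFourier.ae_lightlike (h : C.HasFourier m T) :
    ∀ᵐ k ∂m, mink k k = 0 → ∀ μ ν,
      ((k 0 ^ 2 : ℝ) : ℂ) * T k μ ν = T k 0 0 * ((lower k μ * lower k ν : ℝ) : ℂ) := by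
  have key : ∀ j : Fin 4 × Fin 4, ∀ᵐ k ∂m, mink k k = 0 →
      ((k 0 ^ 2 : ℝ) : ℂ) * T k j.1 j.2 = T k 0 0 * ((lower k j.1 * lower k j.2 : ℝ) : ℂ) := by
    intro j
    have e : ∀ (k : FourVec) (S : Tensor), ∑ i : Fin 4 × Fin 4,
        (((if i = j then k 0 ^ 2 else 0) - if i = 0 then lower k j.1 * lower k j.2 else 0 : ℝ) : ℂ) *
          S i.1 i.2 = ((k 0 ^ 2 : ℝ) : ℂ) * S j.1 j.2 -
            S 0 0 * ((lower k j.1 * lower k j.2 : ℝ) : ℂ) := by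
      intro k S
      simp only [Complex.ofReal_sub, sub_mul, Finset.sum_sub_distrib, apply_ite Complex.ofReal,
        Complex.ofReal_zero, ite_mul, zero_mul, Finset.sum_ite_eq', Finset.mem_univ, if_true]
      simp [mul_comm]
    have := h.ae_sum_eq_zero (c := fun i k =>
      (if i = j then k 0 ^ 2 else 0) - if i = 0 then lower k j.1 * lower k j.2 else 0)
      (φ := fun k => mink k k)
      (fun i => by
        unfold lower
        split_ifs <;> fun_prop)
      contDiff_mink_self (fun p hp hk => by
        rw [e, sheetTensor_of_lightlike hp hk, sheetTensor_zero_zero]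
        ring)
    filter_upwards [this] with k hk h0
    have := hk h0
    rw [e] at this
    exact sub_eq_zero.1 this
  filter_upwards [ae_all_iff.2 key] with k hk ht μ ν
  exact hk (μ, ν) ht

/-- A lightlike `k` has `k 0 ≠ 0`, so `S` is a multiple of `k_μ k_ν`. Every contraction is then a
complex multiple of the real null covector `k_ν`, and the quadratic form is exactly zero. -/
lemma isNonSpacelike_contract {k : FourVec} (hk : IsLightlike k) {S : Tensor}
    (hS : ∀ μ ν, ((k 0 ^ 2 : ℝ) : ℂ) * S μ ν = S 0 0 * ((lower k μ * lower k ν : ℝ) : ℂ))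
    (l : FourVec) : IsNonSpacelike (contract l S) := by
  have h0 : k 0 ≠ 0 := by
    intro h0
    refine hk.1 ?_
    have := hk.2
    rw [mink_eq, h0] at this
    ext i
    fin_cases i
    · exact h0
    all_goals simp; nlinarith [sq_nonneg (k 1), sq_nonneg (k 2), sq_nonneg (k 3)]
  have h0' : ((k 0 ^ 2 : ℝ) : ℂ) ≠ 0 := Complex.ofReal_ne_zero.2 (pow_ne_zero 2 h0)
  obtain ⟨a, ha⟩ : ∃ a : ℂ, ∀ ν, contract l S ν = a * (lower k ν : ℝ) := by
    refine ⟨∑ μ, (l μ : ℂ) * (S 0 0 * (lower k μ : ℝ) / ((k 0 ^ 2 : ℝ) : ℂ)), fun ν => ?_⟩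
    rw [contract, Finset.sum_mul]
    refine Finset.sum_congr rfl fun μ _ => ?_
    have := hS μ ν
    rw [Complex.ofReal_mul] at this
    field_simp
    linear_combination (l μ : ℂ) * this
  intro c
  have h1 : ∀ ν, eta ν * (c * contract l S ν).re ^ 2 = (c * a).re ^ 2 * (eta ν * k ν * k ν) := by
    intro ν
    rw [ha, ← mul_assoc, Complex.re_mul_ofReal, lower]
    by_cases h : ν = 0 <;> simp [eta, h] <;> ring
  simp_rw [h1]
  rw [← Finset.mul_sum]
  change _ * mink k k ≤ 0
  rw [hk.2, mul_zero]

lemma Distribution.HasFourier.ae_restrictions (h : C.HasFourier m T) :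
    ∀ᵐ k ∂m, Restrictions k (T k) := by
  filter_upwards [h.ae_conserved, h.ae_timelike, h.ae_lightlike] with k h1 h2 h3
  exact ⟨h1, h2, fun hk l _ => isNonSpacelike_contract hk (h3 hk.2) l⟩

end HasFourier

/-! ### Existence of the Fourier transform -/

/-- The factorisation of an integrable function through a finite measure. -/
lemma exists_finite_measure_factorization {α : Type*} [MeasurableSpace α] {μ : Measure α}
    {R : α → ℂ} (hR : Integrable R μ) :
    ∃ (n : Measure α) (s : α → ℂ), IsFiniteMeasure n ∧ n ≪ μ ∧ Measurable s ∧ (∀ x, ‖s x‖ ≤ 1) ∧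
      ∀ F : α → ℂ, ∫ x, R x * F x ∂μ = ∫ x, s x * F x ∂n := by
  set R' := hR.aestronglyMeasurable.mk R with hR'
  have hm : Measurable R' := hR.aestronglyMeasurable.stronglyMeasurable_mk.measurable
  have hRR : R =ᵐ[μ] R' := hR.aestronglyMeasurable.ae_eq_mk
  have hfin : ∫⁻ x, ‖R' x‖ₑ ∂μ ≠ ⊤ := (hR.congr hRR).2.ne
  -- Polar decomposition: total variation and phase. Where `R'` vanishes the phase is `0 / 0 = 0`,
  -- which is harmless.
  refine ⟨μ.withDensity fun x => ‖R' x‖ₑ, fun x => R' x / ‖R' x‖, isFiniteMeasure_withDensity hfin,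
    withDensity_absolutelyContinuous _ _, ?_, fun x => ?_, fun F => ?_⟩
  · exact hm.div (Complex.measurable_ofReal.comp hm.norm)
  · rw [norm_div, Complex.norm_real, norm_norm]
    exact div_self_le_one _
  · rw [integral_withDensity_eq_integral_toReal_smul hm.enorm (by simp)]
    refine integral_congr_ae ?_
    filter_upwards [hRR] with x hx
    rw [hx, toReal_enorm, Complex.real_smul]
    by_cases h0 : R' x = 0
    · simp [h0]
    · have : (‖R' x‖ : ℂ) ≠ 0 := by exact_mod_cast norm_ne_zero_iff.2 h0
      field_simp

/-- After division by the polynomial growth the amplitude is a phase `s` times a finite measure. The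
joint measure of `(fourWave p, p)` disintegrates over its first coordinate, and `T k` is the
conditional mean of `s` times the sheet tensor with the polynomial factor restored. -/
lemma Distribution.exists_hasFourier (C : Distribution) :
    ∃ (m : Measure FourVec) (T : FourVec → Tensor), SigmaFinite m ∧ C.HasFourier m T := by
  obtain ⟨N, hN⟩ := C.exists_integrable
  obtain ⟨n, s, hn, hac, hs, hs1, hns⟩ := exists_finite_measure_factorization hN
  have hmeas : Measurable fun p : Laminar => (fourWave p, p) :=
    Continuous.measurable (by fun_prop)
  set ρ : Measure (FourVec × Laminar) := n.map fun p => (fourWave p, p) with hρ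
  have : IsFiniteMeasure ρ := Measure.isFiniteMeasure_map n _
  have hphys : ∀ᵐ p ∂n, IsPhysical p := hac.ae_le C.physical
  have hpow : ∀ k : FourVec, (((1 + ‖k‖) ^ N : ℝ) : ℂ) ≠ 0 := fun k => by
    exact_mod_cast (by positivity : (1 + ‖k‖) ^ N ≠ 0)
  have hint : ∀ (G : FourVec → ℂ), Continuous G → (∃ B, ∀ k, ‖G k‖ ≤ B) → ∀ μ ν,
      Integrable (fun q : FourVec × Laminar =>
        s q.2 * sheetTensor q.2.2.1 q.2.2.2 μ ν * G q.1) ρ := by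
    rintro G hG ⟨B, hB⟩ μ ν
    obtain ⟨D, hD0, hD⟩ := exists_norm_le_of_isPhysical (continuous_sheetTensor_apply μ ν)
    have hm1 : Measurable fun q : FourVec × Laminar =>
        s q.2 * sheetTensor q.2.2.1 q.2.2.2 μ ν * G q.1 := by
      have : Measurable fun q : FourVec × Laminar => sheetTensor q.2.2.1 q.2.2.2 μ ν :=
        ((continuous_sheetTensor_apply μ ν).measurable.comp measurable_snd).comp measurable_snd
      exact ((hs.comp measurable_snd).mul this).mul (hG.measurable.comp measurable_fst)
    rw [hρ, integrable_map_measure hm1.aestronglyMeasurable hmeas.aemeasurable]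
    refine Integrable.of_bound (hm1.comp hmeas).aestronglyMeasurable (1 * D * B) ?_
    filter_upwards [hphys] with p hp
    simp only [Function.comp, norm_mul]
    have := hD p hp
    gcongr
    exacts [hs1 p, hB _]
  refine ⟨ρ.fst, fun k μ ν => (((1 + ‖k‖) ^ N : ℝ) : ℂ) *
    ∫ p, s p * sheetTensor p.2.1 p.2.2 μ ν ∂(ρ.condKernel k), inferInstance, fun μ ν => ⟨N, ?_⟩,
    fun f μ ν => ?_⟩
  · have h1 := hint (fun _ => 1) continuous_const ⟨1, by simp⟩ μ ν
    rw [← ρ.disintegrate ρ.condKernel] at h1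
    rw [Measure.compProd] at h1
    have h2 : Integrable (fun k => ∫ p, s p * sheetTensor p.2.1 p.2.2 μ ν * 1 ∂(ρ.condKernel k))
        ρ.fst := Integrable.integral_compProd h1
    refine h2.congr (Filter.Eventually.of_forall fun k => ?_)
    simp only [mul_one]
    rw [inv_mul_cancel_left₀ (hpow k)]
  · set G : FourVec → ℂ := fun k => (((1 + ‖k‖) ^ N : ℝ) : ℂ) * waveTransform f k with hG
    have hGc : Continuous G := by
      have := continuous_waveTransform f
      fun_prop
    have hGb : ∃ B, ∀ k, ‖G k‖ ≤ B := by
      obtain ⟨B, hB⟩ := rapidDecay_waveTransform f N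
      refine ⟨B, fun k => ?_⟩
      rw [hG, norm_mul, Complex.norm_real, Real.norm_of_nonneg (by positivity)]
      exact hB k
    have h1 := hint G hGc hGb μ ν
    rw [C.T_eq]
    calc _ = ∫ p, ((((1 + ‖fourWave p‖) ^ N : ℝ) : ℂ)⁻¹ * C.weight p) *
          (sheetTensor p.2.1 p.2.2 μ ν * G (fourWave p)) ∂C.measure := by
            refine integral_congr_ae (Filter.Eventually.of_forall fun p => ?_)
            have := hpow (fourWave p)
            simp only [hG]
            field_simp
      _ = ∫ p, s p * (sheetTensor p.2.1 p.2.2 μ ν * G (fourWave p)) ∂n := hns _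
      _ = ∫ q, s q.2 * sheetTensor q.2.2.1 q.2.2.2 μ ν * G q.1 ∂ρ := by
            rw [hρ, integral_map hmeas.aemeasurable h1.aestronglyMeasurable]
            simp only [mul_assoc]
      _ = ∫ q, s q.2 * sheetTensor q.2.2.1 q.2.2.2 μ ν * G q.1 ∂(ρ.fst.compProd ρ.condKernel) := by
            rw [ρ.disintegrate ρ.condKernel]
      _ = ∫ k, ∫ p, s p * sheetTensor p.2.1 p.2.2 μ ν * G k ∂(ρ.condKernel k) ∂ρ.fst := by
            rw [← ρ.disintegrate ρ.condKernel] at h1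
            rw [Measure.integral_compProd h1]
      _ = _ := by
            refine integral_congr_ae (Filter.Eventually.of_forall fun k => ?_)
            simp only [hG, integral_mul_const, waveTransform]
            ring

lemma restrictions_zero (k : FourVec) : Restrictions k 0 where
  conserved ν := by simp [contract]
  timelike _ := rfl
  lightlike _ l _ c := by simp [contract]

lemma Distribution.exists_hasFourier_restrictions (C : Distribution) :
    ∃ (m : Measure FourVec) (T : FourVec → Tensor),
      SigmaFinite m ∧ C.HasFourier m T ∧ ∀ k, Restrictions k (T k) := by
  classical
  obtain ⟨m, T, hm, h⟩ := C.exists_hasFourier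
  -- The exceptional `k` form a null set; there `T k` is replaced by `0`, which obeys all
  -- restrictions.
  have hae : ∀ᵐ k ∂m, (if Restrictions k (T k) then T k else 0) = T k := by
    filter_upwards [h.ae_restrictions] with k hk
    rw [if_pos hk]
  refine ⟨m, fun k => if Restrictions k (T k) then T k else 0, hm, ⟨fun μ ν => ?_, fun f μ ν => ?_⟩,
    fun k => ?_⟩
  · obtain ⟨N, hN⟩ := h.1 μ ν
    refine ⟨N, hN.congr ?_⟩
    filter_upwards [hae] with k hk
    rw [hk]
  · rw [h.2 f μ ν]
    refine integral_congr_ae ?_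
    filter_upwards [hae] with k hk
    simp only [hk]
  · by_cases hk : Restrictions k (T k)
    · simpa only [if_pos hk] using hk
    · simpa only [if_neg hk] using restrictions_zero k

/-! ### Superpositions of sheet tensors with a continuous weight -/

lemma Tensor.linearMap_apply (φ : Tensor →ₗ[ℂ] ℂ) (A : Tensor) :
    φ A = ∑ μ, ∑ ν, A μ ν * φ (Matrix.single μ ν 1) := by
  conv_lhs => rw [Matrix.matrix_eq_sum_single A]
  simp only [map_sum]
  refine Finset.sum_congr rfl fun μ _ => Finset.sum_congr rfl fun ν _ => ?_
  rw [← smul_eq_mul, ← map_smul, Matrix.smul_single, smul_eq_mul, mul_one]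

section Gram

variable {M : Measure Laminar} [IsFiniteMeasure M]

lemma integrable_of_ae_isPhysical (hM : ∀ᵐ p ∂M, IsPhysical p) {F : Space × Space → ℂ}
    (hF : Continuous F) : Integrable (fun p : Laminar => F p.2) M := by
  obtain ⟨B, -, hB⟩ := exists_norm_le_of_isPhysical hF
  refine Integrable.of_bound (hF.comp continuous_snd).aestronglyMeasurable B ?_
  filter_upwards [hM] with p hp using hB p hp

/-- A tensor on which each functional annihilating the sheet tensors vanishes is a superposition of
sheet tensors with a continuous weight. -/
lemma exists_continuous_weight (hM : ∀ᵐ p ∂M, IsPhysical p) {T : Tensor}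
    (hT : ∀ φ : Tensor →ₗ[ℂ] ℂ, (∀ᵐ p ∂M, φ (sheetTensor p.2.1 p.2.2) = 0) → φ T = 0) :
    ∃ w : Space × Space → ℂ, Continuous w ∧
      ∀ μ ν, ∫ p : Laminar, w p.2 * sheetTensor p.2.1 p.2.2 μ ν ∂M = T μ ν := by
  have hint : ∀ {w : Space × Space → ℂ}, Continuous w → ∀ μ ν,
      Integrable (fun p : Laminar => w p.2 * sheetTensor p.2.1 p.2.2 μ ν) M := fun {w} hw μ ν =>
    integrable_of_ae_isPhysical hM (F := fun q => w q * sheetTensor q.1 q.2 μ ν)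
      (hw.mul (continuous_sheetTensor_apply μ ν))
  let V : Submodule ℂ Tensor :=
    { carrier := {A | ∃ w : Space × Space → ℂ, Continuous w ∧
        ∀ μ ν, ∫ p : Laminar, w p.2 * sheetTensor p.2.1 p.2.2 μ ν ∂M = A μ ν}
      zero_mem' := ⟨fun _ => 0, continuous_const, by simp⟩
      add_mem' := by
        rintro A B ⟨w, hw, hA⟩ ⟨z, hz, hB⟩
        refine ⟨fun q => w q + z q, hw.add hz, fun μ ν => ?_⟩
        simp only [add_mul, Matrix.add_apply]
        rw [integral_add (hint hw μ ν) (hint hz μ ν), hA, hB]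
      smul_mem' := by
        rintro c A ⟨w, hw, hA⟩
        refine ⟨fun q => c * w q, continuous_const.mul hw, fun μ ν => ?_⟩
        simp only [mul_assoc, Matrix.smul_apply, smul_eq_mul]
        rw [integral_const_mul, hA] }
  by_contra hcon
  have hTV : T ∉ V := hcon
  obtain ⟨φ, hφT, hφV⟩ := Submodule.exists_le_ker_of_notMem hTV
  refine hφT (hT φ ?_)
  have hφc : Continuous fun q : Space × Space => φ (sheetTensor q.1 q.2) :=
    (LinearMap.continuous_of_finiteDimensional φ).comp continuous_sheetTensor
  -- With this weight, `φ` of the superposition is the integral of `‖φ S‖²`; it vanishes since the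
  -- superposition lies in `V`.
  let w : Space × Space → ℂ := fun q => (starRingEnd ℂ) (φ (sheetTensor q.1 q.2))
  have hw : Continuous w := Complex.continuous_conj.comp hφc
  let A : Tensor := fun μ ν => ∫ p : Laminar, w p.2 * sheetTensor p.2.1 p.2.2 μ ν ∂M
  have hA : φ A = 0 := hφV (show A ∈ V from ⟨w, hw, fun _ _ => rfl⟩)
  have hA' : φ A = ∫ p : Laminar, ((‖φ (sheetTensor p.2.1 p.2.2)‖ ^ 2 : ℝ) : ℂ) ∂M := by
    rw [Tensor.linearMap_apply]
    simp only [A, ← integral_mul_const]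
    simp_rw [← integral_finsetSum _ fun ν _ => (hint hw _ ν).mul_const _]
    rw [← integral_finsetSum _ fun μ _ => integrable_finsetSum _ fun ν _ =>
      (hint hw μ ν).mul_const _]
    refine integral_congr_ae (Filter.Eventually.of_forall fun p => ?_)
    simp only
    rw [Complex.ofReal_pow, ← Complex.conj_mul']
    conv_rhs => rw [Tensor.linearMap_apply φ (sheetTensor p.2.1 p.2.2)]
    simp only [Finset.mul_sum, w, mul_assoc]
    congr! 3
    rw [Tensor.linearMap_apply]
  rw [hA, integral_complex_ofReal, eq_comm, Complex.ofReal_eq_zero, integral_eq_zero_iff_of_nonneg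
    (fun p => sq_nonneg _)] at hA'
  · filter_upwards [hA'] with p hp
    simpa using hp
  · have := integrable_of_ae_isPhysical hM (F := fun q => ((‖φ (sheetTensor q.1 q.2)‖ ^ 2 : ℝ) : ℂ))
      (Complex.continuous_ofReal.comp (hφc.norm.pow 2))
    exact this.re.congr (Filter.Eventually.of_forall fun p => Complex.ofReal_re _)

end Gram

/-! ### Functionals annihilating the sheet tensors -/

/-- The tensor `x_μ y_ν`. -/
def dyad (x y : FourVec) : Tensor := fun μ ν => ((lower x μ * lower y ν : ℝ) : ℂ)

lemma dyad_add_smul (s t : ℝ) (x y : FourVec) :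
    dyad (s • x + t • y) (s • x + t • y) =
      ((s ^ 2 : ℝ) : ℂ) • dyad x x + ((s * t : ℝ) : ℂ) • (dyad x y + dyad y x) +
        ((t ^ 2 : ℝ) : ℂ) • dyad y y := by
  ext μ ν
  simp [dyad, lower]
  ring

lemma sheetTensor_eq (d v : Space) : sheetTensor d v = dyad (fourVec 1 v) (fourVec 1 v) +
    ((‖v‖ ^ 2 - 1 : ℝ) : ℂ) • dyad (fourVec 0 d) (fourVec 0 d) := by
  ext μ ν
  simp only [sheetTensor, dyad, mink_fourVec, real_inner_self_eq_norm_sq, Matrix.add_apply,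
    Matrix.smul_apply, smul_eq_mul, ← Complex.ofReal_mul, ← Complex.ofReal_add]
  congr 1
  ring

section Functional

variable {φ : Tensor →ₗ[ℂ] ℂ}

lemma map_dyad_add_smul (s t : ℝ) (x y : FourVec) :
    φ (dyad (s • x + t • y) (s • x + t • y)) =
      (s : ℂ) ^ 2 * φ (dyad x x) + s * t * φ (dyad x y + dyad y x) + (t : ℂ) ^ 2 * φ (dyad y y) := by
  rw [dyad_add_smul, map_add, map_add, map_smul, map_smul, map_smul]
  simp only [smul_eq_mul]
  push_cast
  ring

/-- The component `e_α` of the identity, projected to the orthogonal complement of `k`. -/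
def projBasis (k : FourVec) (α : Fin 4) : FourVec :=
  eta α • EuclideanSpace.single α 1 - (k α / mink k k) • k

lemma eta_mul_self (α : Fin 4) : eta α * eta α = 1 := by
  by_cases h : α = 0 <;> simp [eta, h]

lemma lower_projBasis (k : FourVec) (α μ : Fin 4) :
    lower (projBasis k α) μ = (if μ = α then 1 else 0) - k α / mink k k * lower k μ := by
  by_cases h : μ = α
  · subst h
    simp [lower, projBasis, mul_sub, eta_mul_self]
    ring
  · simp [lower, projBasis, h]
    ring

/-- For `k = 0` the projection is trivial: the subtracted multiple of `k` is zero. -/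
lemma mink_projBasis {k : FourVec} (hk : IsSpacelike k ∨ k = 0) (α : Fin 4) :
    mink k (projBasis k α) = 0 := by
  rcases hk with hk | rfl
  · have hk' : mink k k ≠ 0 := hk.ne'
    have : mink k (projBasis k α) = k α - k α / mink k k * mink k k := by
      have h1 : ∀ x, mink k x = ∑ μ, k μ * lower x μ := fun x =>
        Finset.sum_congr rfl fun μ _ => by rw [lower]; ring
      rw [h1]
      simp only [lower_projBasis, mul_sub, Finset.sum_sub_distrib, mul_ite, mul_one, mul_zero,
        Finset.sum_ite_eq', Finset.mem_univ, if_true]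
      rw [h1 k, Finset.mul_sum]
      congr 1
      exact Finset.sum_congr rfl fun μ _ => by ring
    rw [this, div_mul_cancel₀ _ hk', sub_self]
  · simp [mink]

/-- The unprojected vectors give back the components of `T`; every correction term contains a
contraction of `T` with `k` in one of its slots, which vanishes by conservation and symmetry. -/
lemma eq_sum_dyad_projBasis (k : FourVec) {T : Tensor} (hs : T.IsSymm)
    (hc : ∀ ν, contract k T ν = 0) :
    T = ∑ α, ∑ β, T α β • dyad (projBasis k α) (projBasis k β) := by
  have hc2 : ∀ μ, ∑ ν, T μ ν * (k ν : ℂ) = 0 := fun μ => by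
    rw [← hc μ, contract]
    exact Finset.sum_congr rfl fun ν _ => by rw [mul_comm, hs.apply]
  have hc1 : ∀ ν, ∑ μ, T μ ν * (k μ : ℂ) = 0 := fun ν => by
    rw [← hc ν, contract]
    exact Finset.sum_congr rfl fun μ _ => mul_comm _ _
  ext μ ν
  simp only [Matrix.sum_apply, Matrix.smul_apply, smul_eq_mul, dyad, lower_projBasis]
  have h1 : ∀ α, ∑ β, T α β * (((((if μ = α then (1 : ℝ) else 0) - k α / mink k k * lower k μ) *
      ((if ν = β then 1 else 0) - k β / mink k k * lower k ν)) : ℝ) : ℂ) =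
      T α ν * (((if μ = α then (1 : ℝ) else 0) - k α / mink k k * lower k μ : ℝ) : ℂ) := by
    intro α
    have : ∀ β, T α β * (((((if μ = α then (1 : ℝ) else 0) - k α / mink k k * lower k μ) *
      ((if ν = β then 1 else 0) - k β / mink k k * lower k ν)) : ℝ) : ℂ) =
      (((if μ = α then (1 : ℝ) else 0) - k α / mink k k * lower k μ : ℝ) : ℂ) *
        (if ν = β then T α β else 0) -
      (((if μ = α then (1 : ℝ) else 0) - k α / mink k k * lower k μ : ℝ) : ℂ) *
        ((lower k ν / mink k k : ℝ) : ℂ) * (T α β * (k β : ℂ)) := by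
      intro β
      by_cases h : ν = β <;> simp only [h, if_true, if_false] <;> push_cast <;> ring
    simp_rw [this]
    rw [Finset.sum_sub_distrib, ← Finset.mul_sum, ← Finset.mul_sum, hc2]
    simp
    ring
  simp_rw [h1]
  have : ∀ α, T α ν * (((if μ = α then (1 : ℝ) else 0) - k α / mink k k * lower k μ : ℝ) : ℂ) =
      (if μ = α then T α ν else 0) - ((lower k μ / mink k k : ℝ) : ℂ) * (T α ν * (k α : ℂ)) := by
    intro α
    by_cases h : μ = α <;> simp only [h, if_true, if_false] <;> push_cast <;> ring
  simp_rw [this]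
  rw [Finset.sum_sub_distrib, ← Finset.mul_sum, hc1]
  simp

/-- Polarisation of the quadratic form kills the symmetrised dyads of the projected basis, and
symmetry of `T` makes `2 φ T` a combination of these. -/
lemma map_eq_zero_of_conserved {k : FourVec} (hk : IsSpacelike k ∨ k = 0) {T : Tensor}
    (hs : T.IsSymm) (hc : ∀ ν, contract k T ν = 0)
    (hφ : ∀ x, mink k x = 0 → φ (dyad x x) = 0) : φ T = 0 := by
  have hpol : ∀ α β, φ (dyad (projBasis k α) (projBasis k β) +
      dyad (projBasis k β) (projBasis k α)) = 0 := by
    intro α β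
    have h1 := map_dyad_add_smul (φ := φ) 1 1 (projBasis k α) (projBasis k β)
    have h2 : mink k ((1 : ℝ) • projBasis k α + (1 : ℝ) • projBasis k β) = 0 := by
      have : mink k ((1 : ℝ) • projBasis k α + (1 : ℝ) • projBasis k β) =
          mink k (projBasis k α) + mink k (projBasis k β) := by
        simp [mink, mul_add, Finset.sum_add_distrib]
      rw [this, mink_projBasis hk, mink_projBasis hk, add_zero]
    rw [hφ _ h2, hφ _ (mink_projBasis hk α), hφ _ (mink_projBasis hk β)] at h1
    simpa using h1.symm
  have hT := congrArg φ (eq_sum_dyad_projBasis k hs hc)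
  simp only [map_sum, map_smul, smul_eq_mul] at hT
  have hT' := hT
  rw [Finset.sum_comm] at hT'
  have h2 : φ T + φ T = 0 := by
    nth_rewrite 1 [hT]
    rw [hT', ← Finset.sum_add_distrib]
    refine Finset.sum_eq_zero fun α _ => ?_
    rw [← Finset.sum_add_distrib]
    refine Finset.sum_eq_zero fun β _ => ?_
    rw [hs.apply α β, ← mul_add, ← map_add, hpol, mul_zero]
  exact add_self_eq_zero.1 h2

lemma map_sheetTensor (d v : Space) : φ (sheetTensor d v) =
    φ (dyad (fourVec 1 v) (fourVec 1 v)) +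
      ((‖v‖ : ℂ) ^ 2 - 1) * φ (dyad (fourVec 0 d) (fourVec 0 d)) := by
  rw [sheetTensor_eq, map_add, map_smul, smul_eq_mul]
  push_cast
  rfl

lemma fourVec_add_smul (s t a b : ℝ) (x y : Space) :
    fourVec (s * a + t * b) (s • x + t • y) = s • fourVec a x + t • fourVec b y := by
  ext i
  fin_cases i <;> simp [fourVec]

lemma fourVec_spatial (x : FourVec) : fourVec (x 0) (spatial x) = x := by
  ext i
  fin_cases i <;> simp [fourVec, spatial]

lemma exists_unit_orthogonal (x : Space) : ∃ d : Space, ‖d‖ = 1 ∧ inner ℝ x d = 0 := by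
  have h : (Submodule.span ℝ {x})ᗮ ≠ ⊥ := by
    intro h
    have h1 := (Submodule.span ℝ {x}).finrank_add_finrank_orthogonal
    rw [h, finrank_bot] at h1
    have h2 := finrank_span_le_card (R := ℝ) ({x} : Set Space)
    simp at h1 h2
    omega
  obtain ⟨y, hy, hy0⟩ := Submodule.exists_mem_ne_zero_of_ne_bot h
  rw [Submodule.mem_orthogonal_singleton_iff_inner_right] at hy
  refine ⟨‖y‖⁻¹ • y, ?_, ?_⟩
  · rw [norm_smul, norm_inv, norm_norm, inv_mul_cancel₀ (norm_ne_zero_iff.2 hy0)]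
  · rw [inner_smul_right, hy, mul_zero]

/-- Each vector is a multiple of a unit vector, orthogonal to everything the vector is. -/
lemma exists_smul_unit (k x : Space) (hx : inner ℝ k x = 0) :
    ∃ (r : ℝ) (d : Space), ‖d‖ = 1 ∧ inner ℝ k d = 0 ∧ x = r • d := by
  by_cases h : x = 0
  · obtain ⟨d, hd, hkd⟩ := exists_unit_orthogonal k
    exact ⟨0, d, hd, hkd, by simp [h]⟩
  · have hn : ‖x‖ ≠ 0 := norm_ne_zero_iff.2 h
    refine ⟨‖x‖, ‖x‖⁻¹ • x, ?_, ?_, ?_⟩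
    · rw [norm_smul, norm_inv, norm_norm, inv_mul_cancel₀ hn]
    · rw [inner_smul_right, hx, mul_zero]
    · rw [smul_smul, mul_inv_cancel₀ hn, one_smul]

/-- Let `Q x = φ (dyad x x)`. Static defects give `Q (0, d) = Q (1, 0)` for unit `d`; defects at
light speed have `u² = 0` and give `Q (1, ±v) = 0`. The sum of the latter two is `4 Q (1, 0)` and
the difference isolates the mixed term, so both vanish. -/
lemma map_dyad_eq_zero_of_homogeneous
    (h : ∀ d v : Space, ‖d‖ = 1 → inner ℝ v d = 0 → ‖v‖ ≤ 1 → φ (sheetTensor d v) = 0)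
    (x : FourVec) : φ (dyad x x) = 0 := by
  set q0 := φ (dyad (fourVec 1 0) (fourVec 1 0)) with hq0
  have hd0 : ∀ d : Space, ‖d‖ = 1 → φ (dyad (fourVec 0 d) (fourVec 0 d)) = q0 := by
    intro d hd
    have := h d 0 hd (by simp) (by simp)
    rw [map_sheetTensor] at this
    simp only [norm_zero] at this
    push_cast at this
    linear_combination -this
  have hexp : ∀ (s t : ℝ) (d : Space), φ (dyad (fourVec s (t • d)) (fourVec s (t • d))) =
      (s : ℂ) ^ 2 * q0 + s * t * φ (dyad (fourVec 1 0) (fourVec 0 d) +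
        dyad (fourVec 0 d) (fourVec 1 0)) + (t : ℂ) ^ 2 * φ (dyad (fourVec 0 d) (fourVec 0 d)) := by
    intro s t d
    have := fourVec_add_smul s t 1 0 0 d
    rw [smul_zero, zero_add, mul_one, mul_zero, add_zero] at this
    rw [this, map_dyad_add_smul]
  have hv : ∀ v : Space, ‖v‖ = 1 → ∀ t : ℝ, t ^ 2 = 1 →
      φ (dyad (fourVec 1 (t • v)) (fourVec 1 (t • v))) = 0 := by
    intro v hv t ht
    obtain ⟨d, hd, hvd⟩ := exists_unit_orthogonal v
    have hn : ‖t • v‖ = 1 := by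
      rw [norm_smul, hv, mul_one, Real.norm_eq_abs, ← sq_eq_sq₀ (abs_nonneg _) zero_le_one, sq_abs,
        ht, one_pow]
    have := h d (t • v) hd (by rw [inner_smul_left, hvd]; simp) hn.le
    rw [map_sheetTensor, hn] at this
    simpa using this
  have hzero : q0 = 0 ∧ ∀ v : Space, ‖v‖ = 1 → φ (dyad (fourVec 1 0) (fourVec 0 v) +
        dyad (fourVec 0 v) (fourVec 1 0)) = 0 := by
    have key : ∀ v : Space, ‖v‖ = 1 → q0 = 0 ∧ φ (dyad (fourVec 1 0) (fourVec 0 v) +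
        dyad (fourVec 0 v) (fourVec 1 0)) = 0 := by
      intro v hv1
      have h1 := hv v hv1 1 (by norm_num)
      have h2 := hv v hv1 (-1) (by norm_num)
      rw [hexp, hd0 v hv1] at h1 h2
      push_cast at h1 h2
      constructor
      · linear_combination (h1 + h2) / 4
      · linear_combination (h1 - h2) / 2
    obtain ⟨d, hd, -⟩ := exists_unit_orthogonal 0
    exact ⟨(key d hd).1, fun v hv => (key v hv).2⟩
  obtain ⟨r, d, hd, -, hx⟩ := exists_smul_unit 0 (spatial x) (by simp)
  rw [← fourVec_spatial x, hx, hexp, hd0 d hd, hzero.1, hzero.2 d hd]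
  ring

/-- The cross product on Euclidean three-space. -/
def cross (x y : Space) : Space := WithLp.toLp 2 (crossProduct x.ofLp y.ofLp)

lemma cross_apply_zero (x y : Space) : cross x y 0 = x 1 * y 2 - x 2 * y 1 := by
  simp [cross, cross_apply]

lemma cross_apply_one (x y : Space) : cross x y 1 = x 2 * y 0 - x 0 * y 2 := by
  simp [cross, cross_apply]

lemma cross_apply_two (x y : Space) : cross x y 2 = x 0 * y 1 - x 1 * y 0 := by
  simp [cross, cross_apply]

lemma inner_cross_left (x y : Space) : inner ℝ x (cross x y) = 0 := by
  simp only [inner_space, cross_apply_zero, cross_apply_one, cross_apply_two]; ring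

lemma inner_cross_right (x y : Space) : inner ℝ y (cross x y) = 0 := by
  simp only [inner_space, cross_apply_zero, cross_apply_one, cross_apply_two]; ring

lemma norm_cross_sq (x y : Space) :
    ‖cross x y‖ ^ 2 = ‖x‖ ^ 2 * ‖y‖ ^ 2 - (inner ℝ x y) ^ 2 := by
  simp only [← real_inner_self_eq_norm_sq, inner_space, cross_apply_zero, cross_apply_one,
    cross_apply_two]
  ring

lemma cross_cross_self {x y : Space} (h : inner ℝ x y = 0) : cross x (cross x y) = -(‖x‖ ^ 2) • y := by
  rw [inner_space] at h
  rw [← real_inner_self_eq_norm_sq, inner_space]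
  ext i
  fin_cases i
  · simp [cross_apply_zero, cross_apply_one, cross_apply_two]; linear_combination (x 0) * h
  · simp [cross_apply_zero, cross_apply_one, cross_apply_two]; linear_combination (x 1) * h
  · simp [cross_apply_zero, cross_apply_one, cross_apply_two]; linear_combination (x 2) * h

lemma mink_self_eq (k : FourVec) : mink k k = ‖spatial k‖ ^ 2 - k 0 ^ 2 := by
  rw [← fourVec_spatial k, mink_fourVec, fourVec_spatial, real_inner_self_eq_norm_sq]; ring

lemma laminarOf_eq (k : FourVec) (q : Space × ℝ) : laminarOf k q =
    (spatial k, q.1, (k 0 / ‖spatial k‖ ^ 2) • spatial k +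
      (q.2 / ‖spatial k‖ ^ 2) • cross (spatial k) q.1) := rfl

lemma norm_sq_laminarOf_velocity {k : FourVec} (hk : spatial k ≠ 0) {d : Space} (hd : ‖d‖ = 1)
    (hkd : inner ℝ (spatial k) d = 0) (s : ℝ) :
    ‖(laminarOf k (d, s)).2.2‖ ^ 2 = (k 0 ^ 2 + s ^ 2) / ‖spatial k‖ ^ 2 := by
  have hc : ‖spatial k‖ ≠ 0 := norm_ne_zero_iff.2 hk
  rw [laminarOf_eq, norm_add_sq_real, norm_smul, norm_smul, mul_pow, mul_pow, norm_cross_sq, hkd, hd,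
    inner_smul_left, inner_smul_right, inner_cross_left, Real.norm_eq_abs, Real.norm_eq_abs, sq_abs,
    sq_abs]
  simp only [mul_zero, add_zero]
  field_simp
  ring

lemma spatial_ne_zero {k : FourVec} (hk : IsSpacelike k) : spatial k ≠ 0 := by
  intro h
  have h1 : 0 < mink k k := hk
  rw [mink_self_eq, h, norm_zero] at h1
  nlinarith [sq_nonneg (k 0)]

/-- Let `Q x = φ (dyad x x)`, `c = |K|`, and let `n` be a unit vector orthogonal to `K`. The wave
with direction `n` and `s = 0` gives `Q a = (κ/c)² Q (0, n)`. The two waves at light speed, `s =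
±κ`, with direction orthogonal to `K` and `n`, give `Q (a ± (κ/c) (0, n)) = 0`. Since `κ > 0`, these
three equations make `Q` vanish on the span of `a` and `(0, n)`. -/
lemma map_dyad_eq_zero_of_spacelike {k : FourVec} (hk : IsSpacelike k)
    (h : ∀ d s, ‖d‖ = 1 → inner ℝ (spatial k) d = 0 → s ∈ Set.Icc (-√(mink k k)) (√(mink k k)) →
      φ (sheetTensor d (laminarOf k (d, s)).2.2) = 0)
    (x : FourVec) (hx : mink k x = 0) : φ (dyad x x) = 0 := by
  have hK := spatial_ne_zero hk
  set K := spatial k with hKdef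
  set c := ‖K‖ with hcdef
  have hc : c ≠ 0 := norm_ne_zero_iff.2 hK
  have hcC : (c : ℂ) ≠ 0 := by exact_mod_cast hc
  set a := fourVec 1 ((k 0 / c ^ 2) • K) with ha
  set κ := √(mink k k) with hκ
  have hκpos : 0 < κ := Real.sqrt_pos.2 hk
  have hκsq : κ ^ 2 = c ^ 2 - k 0 ^ 2 := by rw [hκ, Real.sq_sqrt (le_of_lt hk), mink_self_eq]
  have hκC : (κ : ℂ) ^ 2 = (c : ℂ) ^ 2 - (k 0 : ℂ) ^ 2 := by exact_mod_cast hκsq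
  have hexp : ∀ d s, ‖d‖ = 1 → inner ℝ K d = 0 → s ∈ Set.Icc (-κ) κ →
      φ (dyad a a) + (s / c) * φ (dyad a (fourVec 0 (c⁻¹ • cross K d)) +
        dyad (fourVec 0 (c⁻¹ • cross K d)) a) + (s / c) ^ 2 *
        φ (dyad (fourVec 0 (c⁻¹ • cross K d)) (fourVec 0 (c⁻¹ • cross K d))) +
        (((k 0 : ℂ) ^ 2 + (s : ℂ) ^ 2) / (c : ℂ) ^ 2 - 1) *
          φ (dyad (fourVec 0 d) (fourVec 0 d)) = 0 := by
    intro d s hd hkd hs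
    have h1 := h d s hd hkd hs
    have h2 : fourVec 1 (laminarOf k (d, s)).2.2 =
        (1 : ℝ) • a + (s / c) • fourVec 0 (c⁻¹ • cross K d) := by
      rw [← fourVec_add_smul, laminarOf_eq]
      congr 1
      · ring
      · rw [one_smul, smul_smul]
        field_simp
        rfl
    have h3 : ((‖(laminarOf k (d, s)).2.2‖ : ℝ) : ℂ) ^ 2 = (((k 0 ^ 2 + s ^ 2) / c ^ 2 : ℝ) : ℂ) := by
      rw [← Complex.ofReal_pow, norm_sq_laminarOf_velocity hK hd hkd s]
    rw [map_sheetTensor, h2, map_dyad_add_smul, h3] at h1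
    push_cast at h1
    rw [one_pow, one_mul, one_mul] at h1
    exact h1
  have key : ∀ n, ‖n‖ = 1 → inner ℝ K n = 0 → φ (dyad a a) = 0 ∧
      φ (dyad a (fourVec 0 n) + dyad (fourVec 0 n) a) = 0 ∧
        φ (dyad (fourVec 0 n) (fourVec 0 n)) = 0 := by
    intro n hn hkn
    -- This direction is chosen so that the transverse velocity `K × d / c` is `n` itself (`hdn`).
    have hd : ‖-c⁻¹ • cross K n‖ = 1 := by
      rw [← sq_eq_sq₀ (norm_nonneg _) zero_le_one, norm_smul, mul_pow, norm_cross_sq, hkn, hn, norm_neg,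
        norm_inv, Real.norm_of_nonneg (norm_nonneg _)]
      field_simp
      ring
    have hkd : inner ℝ K (-c⁻¹ • cross K n) = 0 := by
      rw [inner_smul_right, inner_cross_left, mul_zero]
    have hdn : c⁻¹ • cross K (-c⁻¹ • cross K n) = n := by
      have : cross K (-c⁻¹ • cross K n) = (-c⁻¹) • cross K (cross K n) := by
        simp [cross]
      rw [this, cross_cross_self hkn, smul_smul, smul_smul]
      convert one_smul ℝ n using 2
      field_simp
      rfl
    have h0 := hexp n 0 hn hkn ⟨by linarith, hκpos.le⟩
    have h1 := hexp _ κ hd hkd ⟨by linarith, le_rfl⟩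
    have h2 := hexp _ (-κ) hd hkd ⟨le_rfl, by linarith⟩
    rw [hdn] at h1 h2
    have e0 : ((k 0 : ℂ) ^ 2 + (κ : ℂ) ^ 2) / (c : ℂ) ^ 2 - 1 = 0 := by
      rw [hκC]; field_simp; ring
    have e1 : (k 0 : ℂ) ^ 2 / (c : ℂ) ^ 2 - 1 = -(κ / c) ^ 2 := by
      rw [div_pow, hκC]; field_simp; ring
    have hkc : (κ : ℂ) / c ≠ 0 := div_ne_zero (by exact_mod_cast hκpos.ne') hcC
    push_cast at h0 h1 h2
    rw [neg_sq] at h2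
    rw [e0, neg_div] at h2
    rw [e0] at h1
    rw [zero_pow two_ne_zero, add_zero, e1] at h0
    have ha0 : φ (dyad a a) = 0 := by
      linear_combination (h1 + h2) / 4 + h0 / 2
    refine ⟨ha0, ?_, ?_⟩
    · have : (κ : ℂ) / c * φ (dyad a (fourVec 0 n) + dyad (fourVec 0 n) a) = 0 := by
        linear_combination (h1 - h2) / 2
      exact (mul_eq_zero.1 this).resolve_left hkc
    · have : ((κ : ℂ) / c) ^ 2 * φ (dyad (fourVec 0 n) (fourVec 0 n)) = 0 := by
        linear_combination ha0 - h0
      exact (mul_eq_zero.1 this).resolve_left (pow_ne_zero 2 hkc)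
  -- Subtracting `x 0 • a` from `x` leaves a purely spatial vector, orthogonal to `K` because `a`
  -- and `x` are both orthogonal to `k`.
  have hxs : inner ℝ K (spatial x - (x 0 * (k 0 / c ^ 2)) • K) = 0 := by
    rw [← fourVec_spatial k, ← fourVec_spatial x, mink_fourVec, ← hKdef] at hx
    rw [inner_sub_right, inner_smul_right, real_inner_self_eq_norm_sq, ← hcdef]
    field_simp
    linarith
  obtain ⟨r, d, hd, hkd, hr⟩ := exists_smul_unit K _ hxs
  have hxe : x = x 0 • a + r • fourVec 0 d := by
    rw [← fourVec_add_smul, ← hr, smul_smul, add_sub_cancel, mul_one, mul_zero, add_zero,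
      fourVec_spatial]
  obtain ⟨h1, h2, h3⟩ := key d hd hkd
  rw [hxe, map_dyad_add_smul, h1, h2, h3]
  ring

end Functional

/-! ### The natural measures -/

lemma isClosed_isPhysical_and (k : FourVec) :
    IsClosed {p : Laminar | IsPhysical p ∧ fourWave p = k} := by
  unfold IsPhysical
  refine IsClosed.inter (IsClosed.inter ?_ (IsClosed.inter ?_ (IsClosed.inter ?_ ?_))) ?_
  · exact isClosed_eq (by fun_prop) continuous_const
  · exact isClosed_eq (by fun_prop) continuous_const
  · exact isClosed_eq (by fun_prop) continuous_const
  · exact isClosed_le (f := fun p : Laminar => ‖p.2.2‖) (by fun_prop) continuous_const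
  · exact isClosed_eq continuous_fourWave continuous_const

lemma continuous_laminarOf (k : FourVec) : Continuous (laminarOf k) := by
  have h : Continuous fun q : Space × ℝ => cross (spatial k) q.1 := by
    have : Continuous fun y : Space => cross (spatial k) y := by
      unfold cross
      exact (PiLp.continuous_toLp 2 _).comp
        ((LinearMap.continuous_of_finiteDimensional (crossProduct (spatial k).ofLp)).comp
          (PiLp.continuous_ofLp 2 _))
    exact this.comp continuous_fst
  rw [funext (laminarOf_eq k)]
  fun_prop

lemma continuous_homogeneousOf : Continuous homogeneousOf := by
  unfold homogeneousOf
  fun_prop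

instance (W : Submodule ℝ Space) : IsFiniteMeasure (sphereMeasure W) := by
  unfold sphereMeasure; infer_instance

instance (k : FourVec) : IsFiniteMeasure (fibreMeasure k) := by
  unfold fibreMeasure; infer_instance

lemma measurableSet_homogeneous : MeasurableSet {q : ℝ × ℝ × ℝ × ℝ | q.1 ∈ Set.Icc 0 Real.pi ∧
    q.2.1 ∈ Set.Icc 0 (2 * Real.pi) ∧ q.2.2.1 ^ 2 + q.2.2.2 ^ 2 ≤ 1} := by
  refine IsClosed.measurableSet (IsClosed.inter ?_ (IsClosed.inter ?_ ?_))
  · exact isClosed_Icc.preimage continuous_fst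
  · exact isClosed_Icc.preimage (continuous_fst.comp continuous_snd)
  · exact isClosed_le (f := fun q : ℝ × ℝ × ℝ × ℝ => q.2.2.1 ^ 2 + q.2.2.2 ^ 2) (by fun_prop)
      continuous_const

instance : IsFiniteMeasure homogeneousMeasure := by
  have hfin : volume {q : ℝ × ℝ × ℝ × ℝ | q.1 ∈ Set.Icc 0 Real.pi ∧
      q.2.1 ∈ Set.Icc 0 (2 * Real.pi) ∧ q.2.2.1 ^ 2 + q.2.2.2 ^ 2 ≤ 1} < ⊤ := by
    have hsub : {q : ℝ × ℝ × ℝ × ℝ | q.1 ∈ Set.Icc 0 Real.pi ∧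
      q.2.1 ∈ Set.Icc 0 (2 * Real.pi) ∧ q.2.2.1 ^ 2 + q.2.2.2 ^ 2 ≤ 1} ⊆
        Set.Icc 0 Real.pi ×ˢ Set.Icc 0 (2 * Real.pi) ×ˢ Set.Icc (-1) 1 ×ˢ Set.Icc (-1) 1 := by
      rintro ⟨θ, φ, a, b⟩ ⟨h1, h2, h3⟩
      simp only at h1 h2 h3
      refine ⟨h1, h2, ?_, ?_⟩ <;> constructor <;> simp only <;> nlinarith [sq_nonneg a, sq_nonneg b]
    exact (measure_mono hsub).trans_lt (isCompact_Icc.prod (isCompact_Icc.prod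
      (isCompact_Icc.prod isCompact_Icc))).measure_lt_top
  have h1 : IsFiniteMeasure ((volume.restrict {q : ℝ × ℝ × ℝ × ℝ | q.1 ∈ Set.Icc 0 Real.pi ∧
        q.2.1 ∈ Set.Icc 0 (2 * Real.pi) ∧ q.2.2.1 ^ 2 + q.2.2.2 ^ 2 ≤ 1}).withDensity
      (fun q => ENNReal.ofReal (Real.sin q.1))) := by
    refine isFiniteMeasure_withDensity (ne_of_lt ?_)
    calc _ ≤ ∫⁻ _ in {q : ℝ × ℝ × ℝ × ℝ | q.1 ∈ Set.Icc 0 Real.pi ∧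
        q.2.1 ∈ Set.Icc 0 (2 * Real.pi) ∧ q.2.2.1 ^ 2 + q.2.2.2 ^ 2 ≤ 1}, 1 :=
          lintegral_mono fun q => by
            rw [← ENNReal.ofReal_one]
            exact ENNReal.ofReal_le_ofReal (Real.sin_le_one _)
      _ < ⊤ := by simpa using hfin
  unfold homogeneousMeasure
  infer_instance

instance (k : FourVec) : IsFiniteMeasure (modeMeasure k) := by
  unfold modeMeasure; split_ifs <;> infer_instance

lemma ae_sphereMeasure (W : Submodule ℝ Space) : ∀ᵐ d ∂sphereMeasure W, ‖d‖ = 1 ∧ d ∈ W := by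
  have hcl : IsClosed {d : Space | ‖d‖ = 1 ∧ d ∈ W} :=
    (isClosed_eq continuous_norm continuous_const).inter W.closed_of_finiteDimensional
  unfold sphereMeasure
  rw [ae_map_iff (by fun_prop) hcl.measurableSet]
  exact Filter.Eventually.of_forall fun d => ⟨norm_eq_of_mem_sphere d, (d : W).2⟩

/-- The longitudinal velocity is fixed by `k·v = ω`; since `|v|² = (ω² + s²) / |k|²`, the speed
limit reads `s² ≤ k_μ k^μ`. -/
lemma laminarOf_physical {k : FourVec} (hk : IsSpacelike k) {d : Space} (hd : ‖d‖ = 1)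
    (hkd : inner ℝ (spatial k) d = 0) {s : ℝ} (hs : s ∈ Set.Icc (-√(mink k k)) (√(mink k k))) :
    IsPhysical (laminarOf k (d, s)) ∧ fourWave (laminarOf k (d, s)) = k := by
  have hK := spatial_ne_zero hk
  have hc : ‖spatial k‖ ≠ 0 := norm_ne_zero_iff.2 hK
  refine ⟨⟨hd, hkd, ?_, ?_⟩, ?_⟩
  · rw [laminarOf_eq]
    simp only [inner_add_left, inner_smul_left, hkd]
    rw [real_inner_comm, inner_cross_right]
    simp
  · have hs2 : s ^ 2 ≤ mink k k := by
      rw [← Real.sq_sqrt (le_of_lt hk)]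
      exact sq_le_sq' hs.1 hs.2
    rw [← abs_of_nonneg (norm_nonneg (laminarOf k (d, s)).2.2), ← sq_le_one_iff_abs_le_one,
      norm_sq_laminarOf_velocity hK hd hkd]
    rw [div_le_one (by positivity)]
    rw [mink_self_eq] at hs2
    linarith
  · have : (inner ℝ (spatial k) (laminarOf k (d, s)).2.2 : ℝ) = k 0 := by
      rw [laminarOf_eq]
      simp only [inner_add_right, inner_smul_right, inner_cross_left, real_inner_self_eq_norm_sq]
      field_simp
      simp
    unfold fourWave
    rw [show (laminarOf k (d, s)).1 = spatial k from rfl, this, fourVec_spatial]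

lemma ae_fibreMeasure {k : FourVec} (hk : IsSpacelike k) :
    ∀ᵐ p ∂fibreMeasure k, IsPhysical p ∧ fourWave p = k := by
  unfold fibreMeasure
  rw [ae_map_iff (continuous_laminarOf k).measurable.aemeasurable
    (isClosed_isPhysical_and k).measurableSet]
  have h1 := (Measure.quasiMeasurePreserving_fst (μ := sphereMeasure (Submodule.span ℝ {spatial k})ᗮ)
    (ν := volume.restrict (Set.Icc (-√(mink k k)) (√(mink k k))))).ae
      (ae_sphereMeasure (Submodule.span ℝ {spatial k})ᗮ)
  have h2 := (Measure.quasiMeasurePreserving_snd (μ := sphereMeasure (Submodule.span ℝ {spatial k})ᗮ)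
    (ν := volume.restrict (Set.Icc (-√(mink k k)) (√(mink k k))))).ae
      (ae_restrict_mem measurableSet_Icc)
  filter_upwards [h1, h2] with q hq hs
  exact laminarOf_physical hk hq.1
    (Submodule.mem_orthogonal_singleton_iff_inner_right.1 hq.2) hs

/-- A continuous function that vanishes almost everywhere on the waves with wave vector `k`
vanishes on all of them. -/
lemma eq_zero_of_ae_fibreMeasure {k : FourVec} (hk : IsSpacelike k) {F : Laminar → ℂ}
    (hF : Continuous F) (h : ∀ᵐ p ∂fibreMeasure k, F p = 0) {d : Space} (hd : ‖d‖ = 1)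
    (hkd : inner ℝ (spatial k) d = 0) {s : ℝ} (hs : s ∈ Set.Icc (-√(mink k k)) (√(mink k k))) :
    F (laminarOf k (d, s)) = 0 := by
  have hG : Continuous fun q => F (laminarOf k q) := hF.comp (continuous_laminarOf k)
  have h1 := Measure.ae_ae_of_ae_prod
    (ae_of_ae_map (continuous_laminarOf k).measurable.aemeasurable h)
  have hκ : 0 < √(mink k k) := Real.sqrt_pos.2 hk
  -- Continuity upgrades the almost-everywhere statement first in `s`, on an interval of positive
  -- length, and afterwards in `d`, as the sphere measure charges open sets.
  have h2 : ∀ᵐ d ∂sphereMeasure (Submodule.span ℝ {spatial k})ᗮ, F (laminarOf k (d, s)) = 0 := by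
    filter_upwards [h1] with d hd
    exact Measure.eqOn_Icc_of_ae_eq volume (by linarith) (g := fun _ => 0) hd
      (hG.comp (by fun_prop : Continuous fun s : ℝ => (d, s))).continuousOn continuousOn_const hs
  have h3 := ae_of_ae_map (f := fun d : Metric.sphere (0 : (Submodule.span ℝ {spatial k})ᗮ) 1 =>
    ((d : (Submodule.span ℝ {spatial k})ᗮ) : Space)) (by fun_prop) h2
  have h4 := (Continuous.ae_eq_iff_eq (μ := (volume : Measure (Submodule.span ℝ {spatial k})ᗮ).toSphere)
    (f := fun d => F (laminarOf k (((d : (Submodule.span ℝ {spatial k})ᗮ) : Space), s)))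
    (g := fun _ => 0) (hG.comp (by fun_prop)) continuous_const).1 h3
  exact congrFun h4 ⟨⟨d, Submodule.mem_orthogonal_singleton_iff_inner_right.2 hkd⟩, by simpa using hd⟩

lemma homogeneousOf_physical {q : ℝ × ℝ × ℝ × ℝ} (hq : q.2.2.1 ^ 2 + q.2.2.2 ^ 2 ≤ 1) :
    IsPhysical (homogeneousOf q) ∧ fourWave (homogeneousOf q) = 0 := by
  obtain ⟨θ, φ, a, b⟩ := q
  simp only at hq
  have h1 := Real.sin_sq_add_cos_sq θ
  have h2 := Real.sin_sq_add_cos_sq φ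
  refine ⟨⟨?_, by simp [homogeneousOf], ?_, ?_⟩, ?_⟩
  · rw [← sq_eq_sq₀ (norm_nonneg _) zero_le_one, ← real_inner_self_eq_norm_sq, inner_space]
    simp [homogeneousOf]
    linear_combination h1 + Real.sin θ ^ 2 * h2
  · rw [inner_space]
    simp [homogeneousOf]
    linear_combination a * Real.sin θ * Real.cos θ * h2
  · rw [← abs_of_nonneg (norm_nonneg (homogeneousOf (θ, φ, a, b)).2.2), ← sq_le_one_iff_abs_le_one,
      ← real_inner_self_eq_norm_sq, inner_space]
    refine le_trans (le_of_eq ?_) hq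
    simp [homogeneousOf]
    linear_combination a ^ 2 * h1 + (a ^ 2 * Real.cos θ ^ 2 + b ^ 2) * h2
  · ext i
    fin_cases i <;> simp [fourWave, fourVec, homogeneousOf]

lemma ae_homogeneousMeasure : ∀ᵐ p ∂homogeneousMeasure, IsPhysical p ∧ fourWave p = 0 := by
  unfold homogeneousMeasure
  rw [ae_map_iff continuous_homogeneousOf.measurable.aemeasurable
    (isClosed_isPhysical_and 0).measurableSet]
  refine (withDensity_absolutelyContinuous _ _).ae_le ?_
  filter_upwards [ae_restrict_mem measurableSet_homogeneous] with q hq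
  exact homogeneousOf_physical hq.2.2

lemma exists_angle {x y : ℝ} (h : x ^ 2 + y ^ 2 = 1) :
    ∃ φ ∈ Set.Icc 0 (2 * Real.pi), Real.cos φ = x ∧ Real.sin φ = y := by
  have hx1 : -1 ≤ x := by nlinarith
  have hx2 : x ≤ 1 := by nlinarith
  have hs : Real.sin (Real.arccos x) = |y| := by
    rw [Real.sin_arccos, show 1 - x ^ 2 = y ^ 2 by linarith, Real.sqrt_sq_eq_abs]
  have h0 := Real.arccos_nonneg x
  have h1 := Real.arccos_le_pi x
  rcases le_total 0 y with hy | hy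
  · exact ⟨Real.arccos x, ⟨h0, by linarith⟩, Real.cos_arccos hx1 hx2, by rw [hs, abs_of_nonneg hy]⟩
  · refine ⟨2 * Real.pi - Real.arccos x, ⟨by linarith, by linarith⟩, ?_, ?_⟩
    · rw [Real.cos_two_pi_sub, Real.cos_arccos hx1 hx2]
    · rw [Real.sin_two_pi_sub, hs, abs_of_nonpos hy, neg_neg]

/-- Spherical coordinates on the homogeneous waves. -/
lemma exists_homogeneousOf {d v : Space} (hd : ‖d‖ = 1) (hvd : inner ℝ v d = 0) (hv : ‖v‖ ≤ 1) :
    ∃ q : ℝ × ℝ × ℝ × ℝ, (q.1 ∈ Set.Icc 0 Real.pi ∧ q.2.1 ∈ Set.Icc 0 (2 * Real.pi) ∧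
      q.2.2.1 ^ 2 + q.2.2.2 ^ 2 ≤ 1) ∧ homogeneousOf q = (0, d, v) := by
  have hd2 : d 0 * d 0 + d 1 * d 1 + d 2 * d 2 = 1 := by
    rw [← inner_space, real_inner_self_eq_norm_sq, hd, one_pow]
  have hv2 : v 0 * v 0 + v 1 * v 1 + v 2 * v 2 ≤ 1 := by
    rw [← inner_space, real_inner_self_eq_norm_sq]
    exact pow_le_one₀ (norm_nonneg _) hv
  rw [inner_space] at hvd
  obtain ⟨θ, φ, hθ, hφ, h0, h1, h2⟩ : ∃ θ φ : ℝ, θ ∈ Set.Icc 0 Real.pi ∧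
      φ ∈ Set.Icc 0 (2 * Real.pi) ∧ d 0 = Real.sin θ * Real.cos φ ∧ d 1 = Real.sin θ * Real.sin φ ∧
        d 2 = Real.cos θ := by
    have hc : Real.cos (Real.arccos (d 2)) = d 2 := Real.cos_arccos
      (by nlinarith [sq_nonneg (d 0), sq_nonneg (d 1)])
      (by nlinarith [sq_nonneg (d 0), sq_nonneg (d 1)])
    have hsc := Real.sin_sq_add_cos_sq (Real.arccos (d 2))
    rw [hc] at hsc
    set σ := Real.sin (Real.arccos (d 2)) with hσ
    have hmem : Real.arccos (d 2) ∈ Set.Icc 0 Real.pi :=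
      ⟨Real.arccos_nonneg _, Real.arccos_le_pi _⟩
    by_cases hs : σ = 0
    -- At the poles the azimuth is arbitrary.
    · refine ⟨Real.arccos (d 2), 0, hmem, ⟨le_rfl, by positivity⟩, ?_, ?_, hc.symm⟩ <;>
        rw [← hσ, hs] <;> rw [hs] at hsc <;>
        nlinarith [sq_nonneg (d 0), sq_nonneg (d 1)]
    · obtain ⟨φ, hφ, hcos, hsin⟩ := exists_angle (x := d 0 / σ) (y := d 1 / σ) (by
        field_simp; linarith)
      refine ⟨Real.arccos (d 2), φ, hmem, hφ, ?_, ?_, hc.symm⟩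
      · rw [hcos, ← hσ]; field_simp
      · rw [hsin, ← hσ]; field_simp
  have e1 := Real.sin_sq_add_cos_sq θ
  have e2 := Real.sin_sq_add_cos_sq φ
  rw [h0, h1, h2] at hvd
  -- The last two coordinates are the components of `v` along `e_θ` and `e_φ`.
  refine ⟨(θ, φ, v 0 * (Real.cos θ * Real.cos φ) + v 1 * (Real.cos θ * Real.sin φ) -
    v 2 * Real.sin θ, -v 0 * Real.sin φ + v 1 * Real.cos φ), ⟨hθ, hφ, ?_⟩, ?_⟩
  · refine le_trans (le_of_eq ?_) hv2
    simp only
    generalize Real.sin θ = s at *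
    generalize Real.cos θ = c at *
    generalize Real.sin φ = s' at *
    generalize Real.cos φ = c' at *
    linear_combination -((v 0 * c' + v 1 * s') * s + v 2 * c) * hvd + ((v 0 * c' + v 1 * s') ^ 2 + v 2 ^ 2) * e1 +
      (v 0 ^ 2 + v 1 ^ 2) * e2
  · simp only [homogeneousOf, Prod.mk.injEq, true_and]
    constructor
    · ext i
      fin_cases i
      · simp [h0]
      · simp [h1]
      · simp [h2]
    · generalize Real.sin θ = s at *
      generalize Real.cos θ = c at *
      generalize Real.sin φ = s' at *
      generalize Real.cos φ = c' at *
      ext i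
      fin_cases i
      · simp
        linear_combination -(s * c') * hvd + c' * (v 0 * c' + v 1 * s') * e1 + v 0 * e2
      · simp
        linear_combination -(s * s') * hvd + s' * (v 0 * c' + v 1 * s') * e1 + v 1 * e2
      · simp
        linear_combination -c * hvd + v 2 * e1

/-- A continuous function that vanishes almost everywhere on the homogeneous waves
vanishes on all of them. -/
lemma eq_zero_of_ae_homogeneousMeasure {F : Laminar → ℂ} (hF : Continuous F)
    (h : ∀ᵐ p ∂homogeneousMeasure, F p = 0) {d v : Space} (hd : ‖d‖ = 1) (hvd : inner ℝ v d = 0)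
    (hv : ‖v‖ ≤ 1) : F (0, d, v) = 0 := by
  have hG : Continuous fun q => F (homogeneousOf q) := hF.comp continuous_homogeneousOf
  obtain ⟨⟨θ, φ, a, b⟩, ⟨hθ, hφ, hab⟩, hq⟩ := exists_homogeneousOf hd hvd hv
  simp only at hθ hφ hab
  rw [← hq]
  -- On the interior of the coordinate domain the density `sin θ` is positive, so vanishing almost
  -- everywhere means vanishing.
  let U : Set (ℝ × ℝ × ℝ × ℝ) := {q | q.1 ∈ Set.Ioo 0 Real.pi ∧ q.2.1 ∈ Set.Ioo 0 (2 * Real.pi) ∧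
    q.2.2.1 ^ 2 + q.2.2.2 ^ 2 < 1}
  have hU : IsOpen U := by
    refine IsOpen.inter (isOpen_Ioo.preimage continuous_fst) (IsOpen.inter
      (isOpen_Ioo.preimage (continuous_fst.comp continuous_snd)) ?_)
    exact isOpen_lt (f := fun q : ℝ × ℝ × ℝ × ℝ => q.2.2.1 ^ 2 + q.2.2.2 ^ 2) (by fun_prop)
      continuous_const
  have hUs : U ⊆ {q : ℝ × ℝ × ℝ × ℝ | q.1 ∈ Set.Icc 0 Real.pi ∧
        q.2.1 ∈ Set.Icc 0 (2 * Real.pi) ∧ q.2.2.1 ^ 2 + q.2.2.2 ^ 2 ≤ 1} := fun q hq =>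
    ⟨Set.Ioo_subset_Icc_self hq.1, Set.Ioo_subset_Icc_self hq.2.1, hq.2.2.le⟩
  have h1 := ae_of_ae_map continuous_homogeneousOf.measurable.aemeasurable h
  rw [ae_withDensity_iff (by fun_prop)] at h1
  have h2 := ae_restrict_of_ae_restrict_of_subset hUs h1
  have h3 : (fun q => F (homogeneousOf q)) =ᵐ[volume.restrict U] fun _ => 0 := by
    filter_upwards [h2, ae_restrict_mem hU.measurableSet] with q hq hqU
    refine hq ?_
    rw [Ne, ENNReal.ofReal_eq_zero, not_le]
    exact Real.sin_pos_of_mem_Ioo hqU.1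
  have h4 := Measure.eqOn_open_of_ae_eq h3 hU hG.continuousOn continuousOn_const
  -- The segment from the centre of the domain to the given point stays in `U` for `t < 1`, so
  -- boundary points are limits of points of `U`.
  let γ : ℝ → ℝ × ℝ × ℝ × ℝ := fun t =>
    (Real.pi / 2 + t * (θ - Real.pi / 2), Real.pi + t * (φ - Real.pi), t * a, t * b)
  have hγ : Continuous γ := by fun_prop
  have hcl : IsClosed {t | F (homogeneousOf (γ t)) = 0} :=
    isClosed_eq (hG.comp hγ) continuous_const
  have hsub : Set.Ico (0 : ℝ) 1 ⊆ {t | F (homogeneousOf (γ t)) = 0} := by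
    rintro t ⟨ht0, ht1⟩
    refine h4 (x := γ t) ⟨⟨?_, ?_⟩, ⟨?_, ?_⟩, ?_⟩
    · simp only [γ]; nlinarith [hθ.1, Real.pi_pos]
    · simp only [γ]; nlinarith [hθ.2, Real.pi_pos]
    · simp only [γ]; nlinarith [hφ.1, Real.pi_pos]
    · simp only [γ]; nlinarith [hφ.2, Real.pi_pos]
    · simp only [γ]
      calc (t * a) ^ 2 + (t * b) ^ 2 = t ^ 2 * (a ^ 2 + b ^ 2) := by ring
        _ ≤ t ^ 2 * 1 := by gcongr
        _ < 1 := by nlinarith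
  have h5 := hcl.closure_subset_iff.2 hsub (by
    rw [closure_Ico zero_ne_one]; exact ⟨zero_le_one, le_rfl⟩ : (1 : ℝ) ∈ closure (Set.Ico (0 : ℝ) 1))
  simpa [γ] using h5

lemma ae_modeMeasure {k : FourVec} (hk : IsSpacelike k ∨ k = 0) :
    ∀ᵐ p ∂modeMeasure k, IsPhysical p ∧ fourWave p = k := by
  unfold modeMeasure
  split_ifs with h
  · rw [h]; exact ae_homogeneousMeasure
  · exact ae_fibreMeasure (hk.resolve_right h)

lemma map_eq_zero_of_ae_modeMeasure {k : FourVec} (hk : IsSpacelike k ∨ k = 0) {T : Tensor}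
    (hs : T.IsSymm) (hc : ∀ ν, contract k T ν = 0) (φ : Tensor →ₗ[ℂ] ℂ)
    (hφ : ∀ᵐ p ∂modeMeasure k, φ (sheetTensor p.2.1 p.2.2) = 0) : φ T = 0 := by
  have hF : Continuous fun p : Laminar => φ (sheetTensor p.2.1 p.2.2) :=
    ((LinearMap.continuous_of_finiteDimensional φ).comp continuous_sheetTensor).comp continuous_snd
  refine map_eq_zero_of_conserved hk hs hc fun x hx => ?_
  unfold modeMeasure at hφ
  split_ifs at hφ with h
  · exact map_dyad_eq_zero_of_homogeneous
      (fun d v hd hvd hv => eq_zero_of_ae_homogeneousMeasure hF hφ hd hvd hv) x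
  · have hk := hk.resolve_right h
    exact map_dyad_eq_zero_of_spacelike hk
      (fun d s hd hkd hs => eq_zero_of_ae_fibreMeasure hk hF hφ hd hkd hs) x hx

/-! ### Reflection of the wave vector -/

/-- The reflection `(k, d, v) ↦ (-k, d, v)` of laminar plane waves. -/
def reflect : Laminar ≃ₜ Laminar := (Homeomorph.neg Space).prodCongr (Homeomorph.refl _)

lemma reflect_apply (p : Laminar) : reflect p = (-p.1, p.2) := rfl

lemma fourWave_reflect (p : Laminar) : fourWave (reflect p) = -fourWave p := by
  ext i
  fin_cases i <;> simp [fourWave, fourVec, reflect_apply]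

lemma spatial_neg (k : FourVec) : spatial (-k) = -spatial k := by
  ext i
  fin_cases i <;> simp [spatial]

lemma mink_neg_neg (k : FourVec) : mink (-k) (-k) = mink k k := by simp [mink]

/-- Under `k ↦ -k` the longitudinal velocity is even and the transverse one is odd, so the velocity
is kept by reversing `s`. -/
lemma laminarOf_neg (k : FourVec) (q : Space × ℝ) :
    laminarOf (-k) q = reflect (laminarOf k (q.1, -q.2)) := by
  have h : cross (-spatial k) q.1 = -cross (spatial k) q.1 := by
    ext i
    fin_cases i <;> (simp [cross_apply_zero, cross_apply_one, cross_apply_two]; ring)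
  rw [laminarOf_eq, laminarOf_eq, reflect_apply, spatial_neg, h]
  simp [neg_div]

lemma fibreMeasure_neg (k : FourVec) : fibreMeasure (-k) = (fibreMeasure k).map reflect := by
  have hW : Submodule.span ℝ {spatial (-k)} = Submodule.span ℝ {spatial k} := by
    rw [spatial_neg, ← Set.neg_singleton, Submodule.span_neg]
  unfold fibreMeasure
  rw [hW, mink_neg_neg, Measure.map_map reflect.measurable (continuous_laminarOf k).measurable]
  set κ := √(mink k k)
  have h1 : MeasurePreserving (fun s : ℝ => -s) (volume.restrict (Set.Icc (-κ) κ))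
      (volume.restrict (Set.Icc (-κ) κ)) := by
    have := (Measure.measurePreserving_neg (volume : Measure ℝ)).restrict_preimage
      (measurableSet_Icc (a := -κ) (b := κ))
    rwa [Set.neg_preimage, Set.neg_Icc, neg_neg] at this
  have h2 := (MeasurePreserving.id (sphereMeasure (Submodule.span ℝ {spatial k})ᗮ)).prod h1
  conv_rhs => rw [← h2.map_eq]
  rw [Measure.map_map (reflect.measurable.comp (continuous_laminarOf k).measurable) h2.measurable]
  congr 1
  funext q
  rw [laminarOf_neg]
  rfl

lemma homogeneousMeasure_map_reflect : homogeneousMeasure.map reflect = homogeneousMeasure := by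
  unfold homogeneousMeasure
  rw [Measure.map_map reflect.measurable continuous_homogeneousOf.measurable]
  congr 1
  funext q
  simp [reflect_apply, homogeneousOf]

lemma modeMeasure_neg (k : FourVec) : modeMeasure (-k) = (modeMeasure k).map reflect := by
  unfold modeMeasure
  by_cases h : k = 0
  · simp [h, homogeneousMeasure_map_reflect]
  · simp [h, fibreMeasure_neg]

/-! ### Distributions with a given single-mode energy–momentum tensor -/

/-- The distribution with an integrable weight with respect to a finite measure. -/
def Distribution.ofFinite (M : Measure Laminar) [IsFiniteMeasure M] (hM : ∀ᵐ p ∂M, IsPhysical p)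
    (w : Laminar → ℂ) (hw : Integrable w M) : Distribution where
  measure := M
  sigmaFinite := inferInstance
  weight := w
  tempered := ⟨0, by simpa using hw⟩
  physical := hM

/-- Almost every wave of `modeMeasure k` has four-wave-vector `k`, so the plane-wave factor leaves
the integral and the weight only has to reproduce `T`. -/
lemma exists_distribution_hasFourier_dirac {k : FourVec} (hk : IsSpacelike k ∨ k = 0) {T : Tensor}
    (hs : T.IsSymm) (hc : ∀ ν, contract k T ν = 0) :
    ∃ C : Distribution, C.measure = modeMeasure k ∧ Continuous C.weight ∧
      C.HasFourier (Measure.dirac k) (fun _ => T) := by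
  have hM := ae_modeMeasure hk
  have hphys : ∀ᵐ p ∂modeMeasure k, IsPhysical p := hM.mono fun _ h => h.1
  obtain ⟨w, hw, hwT⟩ := exists_continuous_weight hphys (map_eq_zero_of_ae_modeMeasure hk hs hc)
  refine ⟨Distribution.ofFinite (modeMeasure k) hphys (fun p => w p.2)
    (integrable_of_ae_isPhysical hphys hw), rfl, hw.comp continuous_snd, fun μ ν => ⟨0, ?_⟩,
    fun f μ ν => ?_⟩
  · simp
  · rw [Distribution.T_eq, integral_dirac]
    change ∫ p, w p.2 * (sheetTensor p.2.1 p.2.2 μ ν * waveTransform f (fourWave p)) ∂modeMeasure k =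
      T μ ν * waveTransform f k
    rw [← hwT μ ν, ← integral_mul_const]
    refine integral_congr_ae ?_
    filter_upwards [hM] with p hp
    rw [hp.2, mul_assoc]

lemma Distribution.isReal_of_reflect {C : Distribution}
    (h1 : MeasurePreserving reflect C.measure C.measure)
    (h2 : ∀ p, C.weight (reflect p) = (starRingEnd ℂ) (C.weight p)) : C.IsReal := by
  intro R B hB _
  have := h1.setIntegral_preimage_emb reflect.measurableEmbedding
    (fun p => (starRingEnd ℂ) (C.weight p)) B
  rw [← integral_conj, ← this]
  refine setIntegral_congr_fun (reflect.measurable hB) fun p _ => ?_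
  simp only [h2, Complex.conj_conj]

lemma wave_neg (k x : FourVec) : wave (-k) x = (starRingEnd ℂ) (wave k x) := by
  have : mink (-k) x = -mink k x := by simp [mink]
  rw [wave, wave, ← Complex.exp_conj, this]
  congr 1
  simp only [map_mul, Complex.conj_ofReal, Complex.conj_I, Complex.conj_ofNat, Complex.ofReal_neg]
  ring

lemma conj_sheetTensor (d v : Space) (μ ν : Fin 4) :
    (starRingEnd ℂ) (sheetTensor d v μ ν) = sheetTensor d v μ ν := Complex.conj_ofReal _

lemma spatial_fourWave (p : Laminar) : spatial (fourWave p) = p.1 := by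
  ext i
  fin_cases i <;> simp [spatial, fourWave, fourVec]

/-- A reflection-symmetric weight on the waves with wave vectors `k` and `-k` yields a real mode. -/
lemma exists_real_distribution_of_weight {k : FourVec} (hk : IsSpacelike k ∨ k = 0)
    {w : Laminar → ℂ} (hw : Continuous w) (hwr : ∀ p, w (reflect p) = (starRingEnd ℂ) (w p))
    (hwi : Integrable w (modeMeasure k)) {A : Tensor}
    (hA : ∀ μ ν, ∫ p, w p * sheetTensor p.2.1 p.2.2 μ ν ∂modeMeasure k = A μ ν) :
    ∃ C : Distribution, C.measure = modeMeasure k + modeMeasure (-k) ∧ Continuous C.weight ∧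
      C.IsReal ∧ ∀ (f : 𝓢(FourVec, ℂ)) (μ ν : Fin 4),
        C.T f μ ν = ∫ x, (((2 * (A μ ν * wave k x).re : ℝ)) : ℂ) * f x := by
  have hM := ae_modeMeasure hk
  have hphys : ∀ᵐ p ∂modeMeasure k, IsPhysical p := hM.mono fun _ h => h.1
  have hk' : IsSpacelike (-k) ∨ -k = 0 := by
    rcases hk with hk | hk
    · left; rwa [IsSpacelike, mink_neg_neg]
    · right; simp [hk]
  have hphys' : ∀ᵐ p ∂(modeMeasure k + modeMeasure (-k)), IsPhysical p :=
    ae_add_measure_iff.2 ⟨hphys, (ae_modeMeasure hk').mono fun _ h => h.1⟩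
  have hemb := reflect.measurableEmbedding
  have hwi' : Integrable w (modeMeasure (-k)) := by
    rw [modeMeasure_neg, hemb.integrable_map_iff]
    refine (integrable_norm_iff (hw.comp reflect.continuous).aestronglyMeasurable).1 ?_
    refine hwi.norm.congr (Filter.Eventually.of_forall fun p => ?_)
    simp [hwr]
  have hpres : MeasurePreserving reflect (modeMeasure k + modeMeasure (-k))
      (modeMeasure k + modeMeasure (-k)) := by
    refine ⟨reflect.measurable, ?_⟩
    rw [Measure.map_add _ _ reflect.measurable, ← modeMeasure_neg, ← modeMeasure_neg, neg_neg, add_comm]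
  let C := Distribution.ofFinite (modeMeasure k + modeMeasure (-k)) hphys' w (hwi.add_measure hwi')
  refine ⟨C, rfl, hw, Distribution.isReal_of_reflect (C := C) hpres hwr, fun f μ ν => ?_⟩
  have hint : Integrable (fun p => w p * (sheetTensor p.2.1 p.2.2 μ ν * waveTransform f (fourWave p)))
      (modeMeasure k + modeMeasure (-k)) :=
    C.integrable_pairing (continuous_sheetTensor_apply μ ν) (continuous_waveTransform f)
      (rapidDecay_waveTransform f)
  rw [Distribution.T_eq]
  change ∫ p, w p * (sheetTensor p.2.1 p.2.2 μ ν * waveTransform f (fourWave p))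
    ∂(modeMeasure k + modeMeasure (-k)) = _
  rw [integral_add_measure hint.left_of_add_measure hint.right_of_add_measure, modeMeasure_neg,
    hemb.integral_map]
  have h1 : ∫ p, w p * (sheetTensor p.2.1 p.2.2 μ ν * waveTransform f (fourWave p)) ∂modeMeasure k =
      A μ ν * waveTransform f k := by
    rw [← hA μ ν, ← integral_mul_const]
    refine integral_congr_ae ?_
    filter_upwards [hM] with p hp
    rw [hp.2, mul_assoc]
  -- Sheet tensors are real and unchanged by reflection, so the modes at `-k` carry the conjugate
  -- tensor.
  have h2 : ∫ p, w (reflect p) * (sheetTensor (reflect p).2.1 (reflect p).2.2 μ ν *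
      waveTransform f (fourWave (reflect p))) ∂modeMeasure k =
      (starRingEnd ℂ) (A μ ν) * waveTransform f (-k) := by
    rw [← hA μ ν, ← integral_conj, ← integral_mul_const]
    refine integral_congr_ae ?_
    filter_upwards [hM] with p hp
    rw [fourWave_reflect, hp.2, hwr, map_mul, conj_sheetTensor, mul_assoc]
    rfl
  rw [h1, h2]
  unfold waveTransform
  rw [← integral_const_mul, ← integral_const_mul,
    ← integral_add ((integrable_wave_mul k f).const_mul _) ((integrable_wave_mul (-k) f).const_mul _)]
  refine integral_congr_ae (Filter.Eventually.of_forall fun x => ?_)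
  simp only
  have h3 := Complex.add_conj (A μ ν * wave k x)
  rw [map_mul] at h3
  rw [wave_neg, ← h3]
  ring

lemma exists_real_distribution {k : FourVec} (hk : IsSpacelike k ∨ k = 0) {T : Tensor}
    (hs : T.IsSymm) (hc : ∀ ν, contract k T ν = 0) :
    ∃ C : Distribution, C.measure = modeMeasure k + modeMeasure (-k) ∧ Continuous C.weight ∧
      C.IsReal ∧ ∀ (f : 𝓢(FourVec, ℂ)) (μ ν : Fin 4),
        C.T f μ ν = ∫ x, (((T μ ν * wave k x).re : ℝ) : ℂ) * f x := by
  have hM := ae_modeMeasure hk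
  have hphys : ∀ᵐ p ∂modeMeasure k, IsPhysical p := hM.mono fun _ h => h.1
  obtain ⟨w, hw, hwT⟩ := exists_continuous_weight hphys (map_eq_zero_of_ae_modeMeasure hk hs hc)
  have hint : ∀ {w : Space × Space → ℂ}, Continuous w → ∀ μ ν, Integrable
      (fun p : Laminar => w p.2 * sheetTensor p.2.1 p.2.2 μ ν) (modeMeasure k) := fun {w} hw μ ν =>
    integrable_of_ae_isPhysical hphys (F := fun q => w q * sheetTensor q.1 q.2 μ ν)
      (hw.mul (continuous_sheetTensor_apply μ ν))
  -- An odd linear function of the wave vector, `±1` at `±k` for spacelike `k` and identically `0`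
  -- for `k = 0`. Multiplying the imaginary part of the weight by it gives a continuous weight that
  -- is conjugated by reflection.
  let χ : Space → ℝ := fun x => inner ℝ x (spatial k) / ‖spatial k‖ ^ 2
  let w' : Laminar → ℂ := fun p => ⟨(w p.2).re / 2, χ p.1 * (w p.2).im / 2⟩
  have hw're : ∀ p, w' p = (((w p.2).re / 2 : ℝ) : ℂ) +
      ((χ p.1 * (w p.2).im / 2 : ℝ) : ℂ) * Complex.I := fun p => Complex.mk_eq_add_mul_I _ _
  have hχ : Continuous χ := by fun_prop
  have hw' : Continuous w' := by
    rw [funext hw're]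
    fun_prop
  have hwr : ∀ p, w' (reflect p) = (starRingEnd ℂ) (w' p) := by
    intro p
    apply Complex.ext
    · simp [w', reflect_apply]
    · simp [w', reflect_apply, χ, neg_div]
  have hχk : ∀ᵐ p ∂modeMeasure k, χ p.1 = χ (spatial k) := by
    filter_upwards [hM] with p hp
    rw [← spatial_fourWave p, hp.2]
  let z : Space × Space → ℂ := fun q => ⟨(w q).re / 2, χ (spatial k) * (w q).im / 2⟩
  have hz : Continuous z := by
    have : z = fun q => (((w q).re / 2 : ℝ) : ℂ) +
      ((χ (spatial k) * (w q).im / 2 : ℝ) : ℂ) * Complex.I := funext fun q =>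
        Complex.mk_eq_add_mul_I _ _
    rw [this]
    fun_prop
  have hwz : ∀ᵐ p ∂modeMeasure k, z p.2 = w' p := hχk.mono fun p hp => by simp only [z, w', hp]
  have hwi : Integrable w' (modeMeasure k) := (integrable_of_ae_isPhysical hphys hz).congr hwz
  obtain ⟨C, h1, h2, h3, h4⟩ := exists_real_distribution_of_weight hk hw' hwr hwi fun _ _ => rfl
  refine ⟨C, h1, h2, h3, fun f μ ν => ?_⟩
  rw [h4]
  have hAz : ∫ p, w' p * sheetTensor p.2.1 p.2.2 μ ν ∂modeMeasure k =
      ∫ p : Laminar, z p.2 * sheetTensor p.2.1 p.2.2 μ ν ∂modeMeasure k :=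
    integral_congr_ae (hwz.mono fun p hp => by simp only [hp])
  simp only [hAz]
  refine integral_congr_ae (Filter.Eventually.of_forall fun x => ?_)
  simp only
  congr 2
  rcases hk with hk | rfl
  · have hχ1 : χ (spatial k) = 1 := by
      simp only [χ, real_inner_self_eq_norm_sq]
      exact div_self (pow_ne_zero 2 (norm_ne_zero_iff.2 (spatial_ne_zero hk)))
    have hzw : ∀ q, z q = 2⁻¹ * w q := fun q => by
      apply Complex.ext <;> simp [z, hχ1] <;> ring
    simp only [hzw, mul_assoc, integral_const_mul, hwT]
    simp
  -- Here `k` and `-k` coincide and only half the real part of `w` survives; the homogeneous measure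
  -- is counted twice, which restores `Re T`.
  · have hχ0 : χ (spatial 0) = 0 := by simp [χ, spatial]
    have hzw : ∀ q, z q = 4⁻¹ * w q + 4⁻¹ * (starRingEnd ℂ) (w q) := fun q => by
      apply Complex.ext <;> simp [z, hχ0]; ring
    have hwave : wave 0 x = 1 := by simp [wave, mink]
    have hwc : Continuous fun q => (starRingEnd ℂ) (w q) := Complex.continuous_conj.comp hw
    have hconj : ∫ p : Laminar, (starRingEnd ℂ) (w p.2) * sheetTensor p.2.1 p.2.2 μ ν ∂modeMeasure 0 =
        (starRingEnd ℂ) (T μ ν) := by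
      rw [← hwT μ ν, ← integral_conj]
      simp only [map_mul, conj_sheetTensor]
    simp only [hzw, add_mul, mul_assoc]
    rw [integral_add ((hint hw μ ν).const_mul _) ((hint hwc μ ν).const_mul _), integral_const_mul,
      integral_const_mul, hwT, hconj, hwave]
    simp
    ring

end LineDefect

end

theorem mainTheorem5 :
    -- every distribution of non-spacelike defects obeys the restrictions
    (∀ C : LineDefect.Distribution,
      (∃ (m : Measure LineDefect.FourVec) (T : LineDefect.FourVec → LineDefect.Tensor),
        SigmaFinite m ∧ C.HasFourier m T ∧ ∀ k, LineDefect.Restrictions k (T k)) ∧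
      (∀ (m : Measure LineDefect.FourVec) (T : LineDefect.FourVec → LineDefect.Tensor),
        SigmaFinite m → C.HasFourier m T → ∀ᵐ k ∂m, LineDefect.Restrictions k (T k))) ∧
    -- every conserved spacelike mode and every zero mode occurs
    (∀ (k : LineDefect.FourVec) (T : LineDefect.Tensor),
      (LineDefect.IsSpacelike k ∨ k = 0) → T.IsSymm → (∀ ν, LineDefect.contract k T ν = 0) →
      (∃ C : LineDefect.Distribution,
        C.measure = LineDefect.modeMeasure k ∧ Continuous C.weight ∧
        C.HasFourier (Measure.dirac k) (fun _ => T)) ∧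
      (∃ C : LineDefect.Distribution,
        C.measure = LineDefect.modeMeasure k + LineDefect.modeMeasure (-k) ∧
        Continuous C.weight ∧ C.IsReal ∧
        ∀ (f : 𝓢(LineDefect.FourVec, ℂ)) (μ ν : Fin 4),
          C.T f μ ν = ∫ x, (((T μ ν * LineDefect.wave k x).re : ℝ) : ℂ) * f x)) := by
  refine ⟨fun C => ⟨C.exists_hasFourier_restrictions, fun m T _ h => h.ae_restrictions⟩,
    fun k T hk hs hc => ⟨LineDefect.exists_distribution_hasFourier_dirac hk hs hc,
      LineDefect.exists_real_distribution hk hs hc⟩⟩
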